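/- **Definitions.** Let $\Psi(\boldsymbol x)=\boldsymbol x/\|\boldsymbol x\|^2$ be the inversion of $\mathbb R^2\setminus\{0\}$ in the unit circle. A nondegenerate frontal in a set $\mathscr C\subset\mathbb R^2$ is a smooth curve $\gamma:I\to\mathscr C$ on an open interval, with $\dot\gamma\neq0$ on a dense subset of $I$, together with a smooth unit vector field $\nu:I\to S^1$ with $\langle\dot\gamma,\nu\rangle=0$. The primitive $\mathcal Pr_{\mathscr C^*}$ is the set of all points $$2\gamma(t)-\frac{\|\gamma(t)\|^2}{\langle\gamma(t),\nu(t)\rangle}\,\nu(t),$$ where $(\gamma,\nu)$ runs over the nondegenerate frontals in $\mathscr C$ and $t$ over the parameters with $\langle\gamma(t),\nu(t)\rangle\ne0$. A front is a smooth curve $\gamma$ with a smooth unit normal $\nu$ such that $(\gamma,\nu)$ is an immersion. An irreducible quadratic curve is a curve with a quadratic equation of nonzero $3\times3$ determinant which is not a union of two (possibly equal) lines. A set has an ordinary cusp (a node) at $p$ if a diffeomorphism between neighbourhoods of $p$ and of the origin takes it to $\{(t^2,t^3)\}$ (to $\{xy=0\}$). **Theorem.** Let $F\in\mathbb R[x,y]$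 be irreducible, and let $\mathscr C$ be the curve $\{F=0\}$, possibly with the origin added as a further point. Let $a,b,r\in\mathbb R$, $r>0$, and suppose that the closure of $\mathcal Pr_{\mathscr C^*}$ is the circle $(x-a)^2+(y-b)^2=r^2$. Put $$Q=(x^2+y^2)^2-2(ax+by)(x^2+y^2)+(a^2-r^2)x^2+(b^2-r^2)y^2+2abxy,$$ $$\lambda(\theta)=\bigl((r+a\cos\theta+b\sin\theta)\cos\theta,\ (r+a\cos\theta+b\sin\theta)\sin\theta\bigr).$$ (1) $\mathscr C=\{Q=0\}$, except that $\mathscr C=\{Q=0\}\setminus\{0\}$ if $a=b=0$ and $0\notin\mathscr C$. For a nonzero constant $c$, $F=cQ$ if $(a,b)\neq(0,0)$, and $(x^2+y^2)F=cQ$ if $a=b=0$. The curve $\mathscr C$ is the limaçon: $\mathscr C=\lambda(\mathbb R)$ if $r^2\le a^2+b^2$, and $\mathscr C\setminus\{0\}=\lambda(\mathbb R)$ if $a^2+b^2<r^2$. Its inversion $\Psi(\mathscr C\setminus\{0\})$ is an irreducible quadratic curve, with the equation $$(r^2-a^2)x^2+(r^2-b^2)y^2-2abxy+2(ax+by)-1=0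 .$$ (2) If $a^2+b^2-r^2=0$, then $\Psi(\mathscr C\setminus\{0\})$ is a parabola and $\mathscr C$ has an ordinary cusp at the origin. (3) If $a^2+b^2-r^2<0$, then $\Psi(\mathscr C\setminus\{0\})$ is an ellipse (possibly a circle); the origin is an isolated point of $\mathscr C$ (provided $0\in\mathscr C$ in the case $a=b=0$); and the other points are non-singular: $\nabla F\ne0$ at every point of $\mathscr C\setminus\{0\}$, and $\lambda'(\theta)\neq0$ for all $\theta$. (4) If $a^2+b^2-r^2>0$, then $\Psi(\mathscr C\setminus\{0\})$ is a hyperbola; $\mathscr C$ has a node at the origin; $\nabla F\ne0$ at every point of $\mathscr C\setminus\{0\}$; and $\mathscr C$ has no singular point as a front: $\lambda$ is a front with $\lambda'(\theta)\neq0$ for all $\theta$. -/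

import Mathlib

open scoped ContDiff

noncomputable section

namespace PlaneCurve

/-- The Euclidean plane. -/
abbrev Plane := EuclideanSpace ℝ (Fin 2)

/-- The real algebraic set `{(x, y) | G(x, y) = 0}`. -/
def zeroSet (G : MvPolynomial (Fin 2) ℝ) : Set Plane :=
  {p | MvPolynomial.eval (fun i => p i) G = 0}

/-- `(γ, ν)` is a Legendrian curve on the (open) parameter set `I`: smooth, with `ν` a unit vector
field normal to `γ`. -/
def IsLegendrianOn (γ ν : ℝ → Plane) (I : Set ℝ) : Prop :=
  ContDiffOn ℝ ∞ γ I ∧ ContDiffOn ℝ ∞ ν I ∧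
    ∀ t ∈ I, ‖ν t‖ = 1 ∧ inner ℝ (deriv γ t) (ν t) = 0

/-- `γ` is a front on the (open) parameter set `I`: it lifts to an immersed Legendrian curve. -/
def IsFrontOn (γ : ℝ → Plane) (I : Set ℝ) : Prop :=
  ∃ ν : ℝ → Plane, IsLegendrianOn γ ν I ∧ ∀ t ∈ I, deriv γ t ≠ 0 ∨ deriv ν t ≠ 0

/-- The point at parameter `t` of the primitive of the frontal `γ` with unit normal `ν`. -/
def primitivePoint (γ ν : ℝ → Plane) (t : ℝ) : Plane :=
  (2 : ℝ) • γ t - (‖γ t‖ ^ 2 / inner ℝ (γ t) (ν t)) • ν t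

/-- The primitive of (the part satisfying `⟨γ, ν⟩ ≠ 0` of) a plane set `S`: all primitive points of
frontals running in `S`, at the parameters where `⟨γ, ν⟩ ≠ 0`. The frontals are nondegenerate
(their regular parameters are dense), so that `ν` is determined up to sign by the tangent lines of
the curve; a frontal resting at one point while its normal turns is not a parametrization of
the curve. -/
def primitive (S : Set Plane) : Set Plane :=
  {q | ∃ (γ ν : ℝ → Plane) (s₁ s₂ t : ℝ), IsLegendrianOn γ ν (Set.Ioo s₁ s₂) ∧
    Set.Ioo s₁ s₂ ⊆ closure {s ∈ Set.Ioo s₁ s₂ | deriv γ s ≠ 0} ∧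
    (∀ s ∈ Set.Ioo s₁ s₂, γ s ∈ S) ∧
    t ∈ Set.Ioo s₁ s₂ ∧ inner ℝ (γ t) (ν t) ≠ 0 ∧ q = primitivePoint γ ν t}

/-- The image of `S`, without the origin, under the inversion in the unit circle. -/
def inversionImage (S : Set Plane) : Set Plane :=
  EuclideanGeometry.inversion (0 : Plane) 1 '' (S \ {0})

/-- The circle `(x - a)² + (y - b)² = r²`. -/
def circle (a b r : ℝ) : Set Plane := {p | (p 0 - a) ^ 2 + (p 1 - b) ^ 2 = r ^ 2}

/-- The parametrization of the (generalized) limaçon, the pedal of the circle with center `(a, b)`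
and radius `r`. -/
def limacon (a b r θ : ℝ) : Plane :=
  !₂[(r + a * Real.cos θ + b * Real.sin θ) * Real.cos θ,
     (r + a * Real.cos θ + b * Real.sin θ) * Real.sin θ]

open MvPolynomial in
/-- The polynomial
`(x² + y²)² - 2(ax + by)(x² + y²) + (a² - r²)x² + (b² - r²)y² + 2abxy`. -/
def limaconPoly (a b r : ℝ) : MvPolynomial (Fin 2) ℝ :=
  (X 0 ^ 2 + X 1 ^ 2) ^ 2 - 2 * (C a * X 0 + C b * X 1) * (X 0 ^ 2 + X 1 ^ 2)
    + C (a ^ 2 - r ^ 2) * X 0 ^ 2 + C (b ^ 2 - r ^ 2) * X 1 ^ 2 + C (2 * a * b) * X 0 * X 1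

/-- The set `(r² - a²)x² + (r² - b²)y² - 2abxy + 2(ax + by) - 1 = 0`. -/
def invConic (a b r : ℝ) : Set Plane :=
  {p | (r ^ 2 - a ^ 2) * p 0 ^ 2 + (r ^ 2 - b ^ 2) * p 1 ^ 2 - 2 * a * b * p 0 * p 1
    + 2 * (a * p 0 + b * p 1) - 1 = 0}

/-- Straight lines. -/
def IsLine (L : Set Plane) : Prop :=
  ∃ q w : Plane, w ≠ 0 ∧ L = Set.range (fun t : ℝ => q + t • w)

/-- `S` is given by a quadratic equation with non-vanishing determinant `Δ`, and is not the union of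
two (possibly equal) lines. -/
def IsIrreducibleQuadraticCurve (S : Set Plane) : Prop :=
  (∃ a₁₁ a₂₂ a₁₂ a₁ a₂ c : ℝ, (a₁₁ ≠ 0 ∨ a₂₂ ≠ 0 ∨ a₁₂ ≠ 0) ∧
    Matrix.det !![a₁₁, a₁₂, a₁; a₁₂, a₂₂, a₂; a₁, a₂, c] ≠ 0 ∧
    S = {p | a₁₁ * p 0 ^ 2 + a₂₂ * p 1 ^ 2 + 2 * a₁₂ * p 0 * p 1 + 2 * a₁ * p 0 + 2 * a₂ * p 1
      + c = 0}) ∧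
  ¬ ∃ L₁ L₂ : Set Plane, IsLine L₁ ∧ IsLine L₂ ∧ S = L₁ ∪ L₂

/-- Ellipses (circles included): `(x/α)² + (y/β)² = 1` in the coordinates of some orthonormal frame
`u, v` at some point `o`. -/
def IsEllipse (S : Set Plane) : Prop :=
  ∃ (o u v : Plane) (α β : ℝ), Orthonormal ℝ ![u, v] ∧ 0 < α ∧ 0 < β ∧
    S = {p | (inner ℝ u (p - o) / α) ^ 2 + (inner ℝ v (p - o) / β) ^ 2 = 1}

/-- Hyperbolas: `(x/α)² - (y/β)² = 1` in some orthonormal frame. -/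
def IsHyperbola (S : Set Plane) : Prop :=
  ∃ (o u v : Plane) (α β : ℝ), Orthonormal ℝ ![u, v] ∧ 0 < α ∧ 0 < β ∧
    S = {p | (inner ℝ u (p - o) / α) ^ 2 - (inner ℝ v (p - o) / β) ^ 2 = 1}

/-- Parabolas: `y = α x²` in some orthonormal frame. -/
def IsParabola (S : Set Plane) : Prop :=
  ∃ (o u v : Plane) (α : ℝ), Orthonormal ℝ ![u, v] ∧ α ≠ 0 ∧
    S = {p | inner ℝ v (p - o) = α * (inner ℝ u (p - o)) ^ 2}

/-- `S` near `p` is mapped onto `T` near `q` by a diffeomorphism between open neighbourhoods of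
`p` and `q`. -/
def LocallyDiffeomorphicAt (S : Set Plane) (p : Plane) (T : Set Plane) (q : Plane) : Prop :=
  ∃ Φ : OpenPartialHomeomorph Plane Plane, p ∈ Φ.source ∧ Φ p = q ∧
    ContDiffOn ℝ ∞ Φ Φ.source ∧ ContDiffOn ℝ ∞ Φ.symm Φ.target ∧
    Φ '' (S ∩ Φ.source) = T ∩ Φ.target

/-- `S` has an ordinary cusp at `p`: it looks locally like `{(t², t³)}` at the origin. -/
def HasOrdinaryCuspAt (S : Set Plane) (p : Plane) : Prop :=
  LocallyDiffeomorphicAt S p (Set.range (fun t : ℝ => (!₂[t ^ 2, t ^ 3] : Plane))) 0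

/-- `S` has a node at `p`: it looks locally like two transversal lines, `xy = 0`, at the origin. -/
def HasNodeAt (S : Set Plane) (p : Plane) : Prop :=
  LocallyDiffeomorphicAt S p {z | z 0 * z 1 = 0} 0

/-- `p` is an isolated point of `S`. -/
def IsIsolatedPointOf (S : Set Plane) (p : Plane) : Prop :=
  ∃ U : Set Plane, IsOpen U ∧ S ∩ U = {p}

/-- The gradient of `G` does not vanish at `p`. -/
def IsNonsingularAt (G : MvPolynomial (Fin 2) ℝ) (p : Plane) : Prop :=
  ∃ i : Fin 2, MvPolynomial.eval (fun j => p j) (MvPolynomial.pderiv i G) ≠ 0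

end PlaneCurve

end

/-! The primitive point `q` of a frontal satisfies `⟨q, γ⟩ = ⟨γ, γ⟩`, and differentiating gives
`⟨q', γ⟩ = 0`: the primitive is the envelope of the lines through `γ` orthogonal to `γ`. Where `q' ≠
0` and `q` runs in the circle with centre `c`, both `γ` and `q - c` are orthogonal to `q'`, hence
parallel. So `(|γ|² - ⟨c, γ⟩)² = r²|γ|²`, which is `Q = 0` (`mem_zeroSet_limaconPoly_of_primitive`).

This holds on infinitely many points of the irreducible curve, so `F ∣ Q`. The alternative, `q' = 0`
for every frontal, puts the curve on the circle with diameter `[0, q]`; two such circles share at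
most one nonzero point, so the primitive would be a single point and its closure not a circle
(`dvd_limaconPoly_of_primitive`).

To get `F = cQ`, substitute `y = mx`: apart from a power of `x`, `Q` becomes a quadratic over `ℝ[m]`
whose discriminant is `1 + m²` times a square. As `1 + m²` is not a square, the quadratic is prime
(`prime_quadratic`). For `a = b = 0`, `Q` splits off `x² + y²`, which has no nonzero real point.

The rest is explicit geometry of `Q`. Inversion turns it into the focus-directrix equation `r²|p|² =
(1 - ⟨c, p⟩)²`. In a frame aligned with `c`, the conic is brought to normal form by completing the
square, and the cusp and the node are straightened by taking roots of functions that do not vanish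
at the origin. -/

noncomputable section

namespace PlaneCurve

/-! ### Gauss's lemma and prime quadratics over `ℝ[m]`. -/

section Gauss

open Polynomial nonZeroDivisors

/-- An irreducible polynomial over a GCD domain and a polynomial that it does not divide generate
an ideal containing a nonzero constant. -/
theorem exists_bezout_const {R : Type*} [CommRing R] [IsDomain R] [IsGCDMonoid R] {f g : R[X]}
    (hf : Irreducible f) (hfg : ¬ f ∣ g) :
    ∃ (d : R) (u v : R[X]), d ≠ 0 ∧ u * f + v * g = C d := by
  by_cases hdeg : f.natDegree = 0
  · obtain ⟨d, hd⟩ := natDegree_eq_zero.mp hdeg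
    refine ⟨d, 1, 0, ?_, by simp [hd]⟩
    rintro rfl
    exact hf.ne_zero (by simp [← hd])
  -- Over the fraction field, Gauss's lemma makes `f` and `g` coprime; `b` and `c` clear the
  -- denominators of a Bézout relation.
  · let K := FractionRing R
    have hp := hf.isPrimitive hdeg
    have hK := (hp.irreducible_iff_irreducible_map_fraction_map (K := K)).mp hf
    have hnd : ¬ f.map (algebraMap R K) ∣ g.map (algebraMap R K) :=
      fun h => hfg (hp.dvd_of_fraction_map_dvd_fraction_map h)
    obtain ⟨u, v, huv⟩ := (hK.coprime_iff_not_dvd).mpr hnd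
    obtain ⟨b, hb, hu⟩ := IsLocalization.integerNormalization_spec R⁰ u
    obtain ⟨c, hc, hv⟩ := IsLocalization.integerNormalization_spec R⁰ v
    refine ⟨b * c, C c * IsLocalization.integerNormalization R⁰ u,
      C b * IsLocalization.integerNormalization R⁰ v,
      mul_ne_zero (nonZeroDivisors.ne_zero hb) (nonZeroDivisors.ne_zero hc), ?_⟩
    apply map_injective _ (IsFractionRing.injective R K)
    rw [Algebra.smul_def, Polynomial.algebraMap_apply] at hu hv
    simp only [Polynomial.map_add, Polynomial.map_mul, Polynomial.map_C, hu, hv, map_mul]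
    linear_combination (C (algebraMap R K b) * C (algebraMap R K c)) * huv

/-- A primitive quadratic polynomial over `ℝ[m]` whose discriminant is `1 + m²` times a square is
prime. -/
theorem prime_quadratic {A B D e : ℝ[X]} (hA : A ≠ 0) (hAD : IsCoprime A D) (he : e ≠ 0)
    (hdisc : B ^ 2 - 4 * A * D = e ^ 2 * (1 + X ^ 2)) :
    Prime (C A * X ^ 2 + C B * X + C D) := by
  rw [← UniqueFactorizationMonoid.irreducible_iff_prime]
  have hp : (C A * X ^ 2 + C B * X + C D).IsPrimitive := by
    intro c hc
    rw [C_dvd_iff_dvd_coeff] at hc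
    have h2 := hc 2
    have h0 := hc 0
    simp at h2 h0
    exact hAD.isUnit_of_dvd' h2 h0
  let K := FractionRing ℝ[X]
  rw [hp.irreducible_iff_irreducible_map_fraction_map (K := K)]
  have hinj : Function.Injective (algebraMap ℝ[X] K) := IsFractionRing.injective _ _
  have hA' : algebraMap ℝ[X] K A ≠ 0 := by simpa using hA
  have he' : algebraMap ℝ[X] K e ≠ 0 := by simpa using he
  apply irreducible_of_degree_le_three_of_not_isRoot
  · simp only [Polynomial.map_add, Polynomial.map_mul, Polynomial.map_C, Polynomial.map_pow,
      Polynomial.map_X]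
    rw [natDegree_quadratic hA']
    simp
  · intro x hx
    simp only [IsRoot, Polynomial.map_add, Polynomial.map_mul, Polynomial.map_C,
      Polynomial.map_pow, Polynomial.map_X, eval_add, eval_mul, eval_C, eval_pow, eval_X] at hx
    have hd := congrArg (algebraMap ℝ[X] K) hdisc
    simp only [map_sub, map_mul, map_pow, map_ofNat] at hd
    -- A root would make `1 + m²` a square in `ℝ(m)`, hence, `ℝ[m]` being integrally closed, the
    -- square of a polynomial. That polynomial has degree one and so a real zero, where `1 + m²`
    -- does not vanish.
    have hsq : ((2 * algebraMap ℝ[X] K A * x + algebraMap ℝ[X] K B) / algebraMap ℝ[X] K e) ^ 2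
        = algebraMap ℝ[X] K (1 + X ^ 2) := by
      rw [div_pow, div_eq_iff (pow_ne_zero 2 he')]
      linear_combination 4 * algebraMap ℝ[X] K A * hx + hd
    obtain ⟨g, hg⟩ := IsIntegrallyClosed.exists_algebraMap_eq_of_isIntegral_pow
      (R := ℝ[X]) (n := 2) two_pos (hsq ▸ isIntegral_algebraMap)
    rw [← hg, ← map_pow] at hsq
    have hg2 : g ^ 2 = 1 + X ^ 2 := hinj hsq
    have hdeg : g.natDegree = 1 := by
      have h := congrArg natDegree hg2
      rw [natDegree_pow, add_comm, show (1 : ℝ[X]) = C 1 from C_1.symm, natDegree_X_pow_add_C] at h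
      lia
    obtain ⟨z, hz⟩ :=
      exists_root_of_degree_eq_one ((degree_eq_iff_natDegree_eq_of_pos one_pos).mpr hdeg)
    have h := congrArg (eval z) hg2
    simp only [eval_pow, hz.eq_zero, eval_add, eval_one, eval_X] at h
    nlinarith [sq_nonneg z]

end Gauss

/-! ### Intersections of plane curves. -/

/-- Polynomials in two variables as polynomials in the first one. -/
def toBivariate : MvPolynomial (Fin 2) ℝ ≃ₐ[ℝ] Polynomial (Polynomial ℝ) :=
  (MvPolynomial.finSuccEquiv ℝ 1).trans
    (Polynomial.mapAlgEquiv (MvPolynomial.uniqueAlgEquiv ℝ (Fin 1)))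

theorem evalEval_toBivariate (x y : ℝ) (G : MvPolynomial (Fin 2) ℝ) :
    (toBivariate G).evalEval y x = MvPolynomial.eval ![x, y] G := by
  have h : ((Polynomial.evalEvalRingHom y x).comp (toBivariate : _ →+* _))
      = MvPolynomial.eval ![x, y] := by
    ext i
    · simp [toBivariate]
    · fin_cases i
      · simp [toBivariate, Polynomial.mapAlgEquiv, MvPolynomial.finSuccEquiv_X_zero]
      · have := MvPolynomial.finSuccEquiv_X_succ (R := ℝ) (n := 1) (j := 0)
        simp at this
        simp [toBivariate, Polynomial.mapAlgEquiv, this]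
  exact congrArg (fun φ => φ G) h

/-- A combination of `F` and `G` is a nonzero polynomial in the second coordinate alone; its roots
are the possible values. -/
theorem exists_finset_second_coord {F G : MvPolynomial (Fin 2) ℝ} (hF : Irreducible F)
    (hFG : ¬ F ∣ G) : ∃ S : Set ℝ, S.Finite ∧
      ∀ v : Fin 2 → ℝ, MvPolynomial.eval v F = 0 → MvPolynomial.eval v G = 0 → v 1 ∈ S := by
  obtain ⟨d, u, w, hd, h⟩ := exists_bezout_const
    ((MulEquiv.irreducible_iff toBivariate).mpr hF)
    (fun h => hFG ((map_dvd_iff toBivariate).mp h))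
  refine ⟨{y | d.IsRoot y}, Polynomial.finite_setOfPred_isRoot hd, fun v h1 h2 => ?_⟩
  have hv : v = ![v 0, v 1] := by ext i; fin_cases i <;> rfl
  rw [hv, ← evalEval_toBivariate] at h1 h2
  have h3 := congrArg (Polynomial.evalEval (v 1) (v 0)) h
  simpa [h1, h2, eq_comm, Polynomial.evalEval_C] using h3

/-- An irreducible plane curve and a curve that does not contain it have finitely many common
points. -/
theorem finite_common_zeros {F G : MvPolynomial (Fin 2) ℝ} (hF : Irreducible F)
    (hFG : ¬ F ∣ G) :
    {v : Fin 2 → ℝ | MvPolynomial.eval v F = 0 ∧ MvPolynomial.eval v G = 0}.Finite := by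
  obtain ⟨S, hS, h1⟩ := exists_finset_second_coord hF hFG
  let e := MvPolynomial.renameEquiv ℝ (Equiv.swap (0 : Fin 2) 1)
  obtain ⟨T, hT, h0⟩ := exists_finset_second_coord (F := e F) (G := e G)
    ((MulEquiv.irreducible_iff e).mpr hF) (fun h => hFG ((map_dvd_iff e).mp h))
  refine (Set.Finite.pi' (t := ![T, S]) (by intro i; fin_cases i <;> simpa)).subset ?_
  rintro v ⟨hvF, hvG⟩ i
  fin_cases i
  · have hc : (v ∘ Equiv.swap (0 : Fin 2) 1) ∘ Equiv.swap (0 : Fin 2) 1 = v := by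
      ext i; simp
    have := h0 (v ∘ Equiv.swap (0 : Fin 2) 1)
      (by simpa [e, MvPolynomial.eval_rename, hc] using hvF)
      (by simpa [e, MvPolynomial.eval_rename, hc] using hvG)
    simpa using this
  · exact h1 v hvF hvG

/-! ### Blow-up at the origin and the irreducible factors of the limaçon polynomial. -/

/-- The substitution `x = s`, `y = m s` (the blow-up of the plane at the origin), as polynomials
in `s` over `ℝ[m]`. -/
def blowUp : MvPolynomial (Fin 2) ℝ →ₐ[ℝ] Polynomial (Polynomial ℝ) :=
  MvPolynomial.aeval ![Polynomial.X, Polynomial.C Polynomial.X * Polynomial.X]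

theorem evalEval_blowUp (m s : ℝ) (G : MvPolynomial (Fin 2) ℝ) :
    (blowUp G).evalEval m s = MvPolynomial.eval ![s, m * s] G := by
  have h : ((Polynomial.evalEvalRingHom m s).comp (blowUp : _ →+* _))
      = MvPolynomial.eval ![s, m * s] := by
    ext i
    · simp [blowUp]
    · fin_cases i
      · simp [blowUp]
      · simp [blowUp, -Polynomial.X_mul_C]
  exact congrArg (fun φ => φ G) h

/-- A polynomial whose total transform under the blow-up is a power of the exceptional divisor, and
which does not vanish on the axis `x = 0`, is constant. -/
theorem eq_C_of_blowUp_dvd {G : MvPolynomial (Fin 2) ℝ} {j : ℕ}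
    (h : blowUp G ∣ Polynomial.X ^ j) {y : ℝ} (hy : MvPolynomial.eval ![0, y] G ≠ 0) :
    ∃ c : ℝ, c ≠ 0 ∧ MvPolynomial.C c * G = 1 := by
  obtain ⟨k, -, u, hu⟩ := (dvd_prime_pow Polynomial.prime_X j).mp h
  obtain ⟨p, hp, hpu⟩ := Polynomial.isUnit_iff.mp u.isUnit
  obtain ⟨c, hc, rfl⟩ := Polynomial.isUnit_iff.mp hp
  have hG : MvPolynomial.C c * G = MvPolynomial.X 0 ^ k := by
    rw [← sub_eq_zero]
    -- The blow-up is invertible only off `x = 0`; multiplying by `X 0` makes the pointwise check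
    -- trivial on that axis.
    refine (mul_eq_zero.mp (MvPolynomial.funext fun v => ?_)).resolve_left
      (MvPolynomial.X_ne_zero (0 : Fin 2))
    by_cases hv : v 0 = 0
    · simp [hv]
    · have h1 := congrArg (Polynomial.evalEval (v 1 / v 0) (v 0)) hu
      rw [← hpu, Polynomial.evalEval_mul, evalEval_blowUp, div_mul_cancel₀ _ hv,
        show ![v 0, v 1] = v by ext i; fin_cases i <;> rfl] at h1
      simp [Polynomial.evalEval_C] at h1
      simp [← h1]
      right; ring
  have hk : k = 0 := by
    by_contra hk
    have h1 := congrArg (MvPolynomial.eval ![0, y]) hG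
    simp [hk, hc.ne_zero, hy] at h1
  exact ⟨c, hc.ne_zero, by simpa [hk] using hG⟩

/-- A polynomial whose strict transform under the blow-up is prime, and which does not vanish on
the axis `x = 0`, is an associate of its irreducible factors. -/
theorem eq_C_mul_of_dvd_of_blowUp {F G : MvPolynomial (Fin 2) ℝ} (hF : Irreducible F) (hFG : F ∣ G)
    {j : ℕ} {K : Polynomial (Polynomial ℝ)} (hK : Prime K) (hGK : blowUp G = Polynomial.X ^ j * K)
    {y : ℝ} (hy : MvPolynomial.eval ![0, y] G ≠ 0) :
    ∃ c : ℝ, c ≠ 0 ∧ F = MvPolynomial.C c * G := by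
  obtain ⟨H, rfl⟩ := hFG
  rw [map_mul] at hy hGK
  have hdvd : K ∣ blowUp F * blowUp H := ⟨Polynomial.X ^ j, by rw [hGK, mul_comm]⟩
  -- The factor that absorbs `K` leaves the other one dividing a power of `s`, hence constant; the
  -- constant factor cannot be `F`.
  rcases hK.dvd_or_dvd hdvd with ⟨L, hL⟩ | ⟨L, hL⟩
  · have hH : blowUp H ∣ Polynomial.X ^ j := by
      refine ⟨L, mul_left_cancel₀ hK.ne_zero ?_⟩
      rw [mul_comm K, ← hGK, hL]
      ring
    obtain ⟨c, hc, h1⟩ := eq_C_of_blowUp_dvd hH (right_ne_zero_of_mul hy)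
    refine ⟨c, hc, ?_⟩
    rw [mul_left_comm, h1, mul_one]
  · have hH : blowUp F ∣ Polynomial.X ^ j := by
      refine ⟨L, mul_left_cancel₀ hK.ne_zero ?_⟩
      rw [mul_comm K, ← hGK, hL]
      ring
    obtain ⟨c, hc, h1⟩ := eq_C_of_blowUp_dvd hH (left_ne_zero_of_mul hy)
    exact absurd (IsUnit.of_mul_eq_one_right _ h1) hF.not_isUnit

theorem eval_limaconPoly (a b r : ℝ) (v : Fin 2 → ℝ) :
    MvPolynomial.eval v (limaconPoly a b r)
      = (v 0 ^ 2 + v 1 ^ 2 - (a * v 0 + b * v 1)) ^ 2 - r ^ 2 * (v 0 ^ 2 + v 1 ^ 2) := by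
  simp [limaconPoly]
  ring

/-- An irreducible factor of the limaçon polynomial is associated with it, unless the limaçon is a
circle. -/
theorem eq_C_mul_limaconPoly_of_dvd {F : MvPolynomial (Fin 2) ℝ} (hF : Irreducible F) {a b r : ℝ}
    (hr : 0 < r) (hab : a ≠ 0 ∨ b ≠ 0) (h : F ∣ limaconPoly a b r) :
    ∃ c : ℝ, c ≠ 0 ∧ F = MvPolynomial.C c * limaconPoly a b r := by
  open Polynomial in
  have hpos : 0 < a ^ 2 + b ^ 2 := by
    rcases hab with h | h
    · have := sq_pos_of_ne_zero h; positivity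
    · have := sq_pos_of_ne_zero h; positivity
  have h1 : (1 + X ^ 2 : ℝ[X]) ≠ 0 := fun h => by
    have := congrArg (eval 0) h
    simp at this
  have hcop : IsCoprime (1 + X ^ 2 : ℝ[X]) (C a + C b * X) := by
    -- From `b²(1 + m²) + (a - bm)(a + bm) = a² + b²`.
    refine ⟨C (b ^ 2 / (a ^ 2 + b ^ 2)), C (1 / (a ^ 2 + b ^ 2)) * (C a - C b * X), ?_⟩
    have h2 : C (1 / (a ^ 2 + b ^ 2)) * (C a ^ 2 + C b ^ 2) = 1 := by
      rw [← C_pow, ← C_pow, ← C_add, ← C_mul, one_div_mul_cancel hpos.ne', C_1]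
    have h3 : C (b ^ 2 / (a ^ 2 + b ^ 2)) = C (1 / (a ^ 2 + b ^ 2)) * C b ^ 2 := by
      rw [← C_pow, ← C_mul]; congr 1; ring
    rw [h3]
    linear_combination h2
  -- On the axis `x = 0` the polynomial is `y²((y - b)² - r²)`, and this `y` has `y - b ≥ 2r`.
  refine eq_C_mul_of_dvd_of_blowUp hF h (j := 2) (y := |b| + 2 * r)
    (prime_quadratic (A := (1 + X ^ 2) ^ 2) (B := -2 * (1 + X ^ 2) * (C a + C b * X))
      (D := (C a + C b * X) ^ 2 + (1 + X ^ 2) * (- C (r ^ 2))) (e := 2 * C r * (1 + X ^ 2))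
      (pow_ne_zero 2 h1) ?_ ?_ ?_) ?_ ?_
  -- Modulo `1 + m²` the constant term is `(a + bm)²`.
  · exact IsCoprime.pow_left (IsCoprime.add_mul_left_right hcop.pow_right _)
  · simp [h1, hr.ne']
  · rw [C_pow]; ring
  · simp [blowUp, limaconPoly, map_ofNat]
    ring
  · rw [eval_limaconPoly]
    have h4 : (|b| + 2 * r) * (r ^ 2) < (|b| + 2 * r) * (|b| + 2 * r - b) ^ 2 := by
      have := le_abs_self b
      have := abs_nonneg b
      gcongr
      linarith
    have h5 : 0 < |b| + 2 * r := by positivity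
    simp
    nlinarith

theorem eq_C_mul_of_dvd_circlePoly {F : MvPolynomial (Fin 2) ℝ} (hF : Irreducible F) {r : ℝ}
    (hr : 0 < r)
    (h : F ∣ MvPolynomial.X 0 ^ 2 + MvPolynomial.X 1 ^ 2 - MvPolynomial.C (r ^ 2)) :
    ∃ c : ℝ, c ≠ 0 ∧
      F = MvPolynomial.C c *
        (MvPolynomial.X 0 ^ 2 + MvPolynomial.X 1 ^ 2 - MvPolynomial.C (r ^ 2)) := by
  open Polynomial in
  have h1 : (1 + X ^ 2 : ℝ[X]) ≠ 0 := fun h => by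
    have := congrArg (eval 0) h
    simp at this
  refine eq_C_mul_of_dvd_of_blowUp hF h (j := 0) (y := 2 * r)
    (prime_quadratic (A := 1 + X ^ 2) (B := 0) (D := - C (r ^ 2)) (e := 2 * C r) h1 ?_ ?_ ?_) ?_ ?_
  · refine (IsCoprime.neg_right_iff _ _).mpr ⟨0, C ((r ^ 2)⁻¹), ?_⟩
    rw [zero_mul, zero_add, ← C_mul, inv_mul_cancel₀ (by positivity), C_1]
  · simp [hr.ne']
  · rw [C_pow]; ring
  · simp [blowUp]
    ring
  · simp; nlinarith

open MvPolynomial in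
/-- If the limaçon is a circle, its irreducible factors with a nonzero real point are associated with
the equation of the circle. -/
theorem eq_C_mul_circlePoly_of_dvd {F : MvPolynomial (Fin 2) ℝ} (hF : Irreducible F) {r : ℝ}
    (hr : 0 < r) (h : F ∣ limaconPoly 0 0 r) {v : Fin 2 → ℝ} (hv : v ≠ 0) (hFv : eval v F = 0) :
    ∃ c : ℝ, c ≠ 0 ∧ F = C c * (X 0 ^ 2 + X 1 ^ 2 - C (r ^ 2)) := by
  have hfac : limaconPoly 0 0 r = (X 0 ^ 2 + X 1 ^ 2) * (X 0 ^ 2 + X 1 ^ 2 - C (r ^ 2)) := by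
    simp [limaconPoly]
    ring
  rw [hfac] at h
  rcases (UniqueFactorizationMonoid.irreducible_iff_prime.mp hF).dvd_or_dvd h with h | h
  · exfalso
    obtain ⟨H, hH⟩ := h
    have h1 := congrArg (eval v) hH
    simp [hFv] at h1
    apply hv
    ext i
    fin_cases i
    · simp; nlinarith [sq_nonneg (v 0), sq_nonneg (v 1)]
    · simp; nlinarith [sq_nonneg (v 0), sq_nonneg (v 1)]
  · exact eq_C_mul_of_dvd_circlePoly hF hr h

/-! ### The primitive of a frontal as an envelope. -/

open Filter Topology Set

theorem dvd_of_infinite {F G : MvPolynomial (Fin 2) ℝ} (hF : Irreducible F) {S : Set Plane}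
    (hS : S.Infinite) (hSF : S ⊆ zeroSet F) (hSG : S ⊆ zeroSet G) : F ∣ G := by
  by_contra h
  refine hS (((finite_common_zeros hF h).preimage
    (f := fun (p : Plane) i => p i) ?_).subset fun p hp => ⟨hSF hp, hSG hp⟩)
  intro p _ q _ hpq
  ext i
  exact congrFun hpq i

theorem inner_plane (p q : Plane) : inner ℝ p q = p 0 * q 0 + p 1 * q 1 := by
  simp [PiLp.inner_apply, Fin.sum_univ_two, mul_comm]

theorem norm_sq_plane (p : Plane) : ‖p‖ ^ 2 = p 0 ^ 2 + p 1 ^ 2 := by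
  simp [EuclideanSpace.norm_sq_eq, Fin.sum_univ_two]

theorem mem_circle_iff {a b r : ℝ} {p : Plane} :
    p ∈ circle a b r ↔ inner ℝ (p - !₂[a, b]) (p - !₂[a, b]) = r ^ 2 := by
  rw [inner_plane]
  simp [circle, sq]

theorem inner_primitivePoint_self {γ ν : ℝ → Plane} {t : ℝ} (h : inner ℝ (γ t) (ν t) ≠ 0) :
    inner ℝ (primitivePoint γ ν t) (γ t) = inner ℝ (γ t) (γ t) := by
  rw [primitivePoint, inner_sub_left, real_inner_smul_left, real_inner_smul_left,
    real_inner_comm (γ t) (ν t), div_mul_cancel₀ _ h, real_inner_self_eq_norm_sq]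
  ring

theorem inner_primitivePoint_of_orthogonal {γ ν : ℝ → Plane} {t : ℝ} {w : Plane}
    (h : inner ℝ w (ν t) = 0) :
    inner ℝ (primitivePoint γ ν t) w = 2 * inner ℝ (γ t) w := by
  rw [primitivePoint, inner_sub_left, real_inner_smul_left, real_inner_smul_left,
    real_inner_comm w (ν t), h]
  ring

section Frontal

variable {γ ν : ℝ → Plane} {I : Set ℝ}

/-- The parameters of a frontal at which the primitive is defined. -/
def primitiveDomain (γ ν : ℝ → Plane) (I : Set ℝ) : Set ℝ := I ∩ {t | inner ℝ (γ t) (ν t) ≠ 0}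

theorem isOpen_primitiveDomain (hI : IsOpen I) (h : IsLegendrianOn γ ν I) :
    IsOpen (primitiveDomain γ ν I) :=
  (h.1.continuousOn.inner h.2.1.continuousOn).isOpen_inter_preimage hI isOpen_ne

theorem contDiffOn_primitivePoint (h : IsLegendrianOn γ ν I) :
    ContDiffOn ℝ ∞ (primitivePoint γ ν) (primitiveDomain γ ν I) := by
  have hγ := h.1.mono (inter_subset_left : primitiveDomain γ ν I ⊆ I)
  have hν := h.2.1.mono (inter_subset_left : primitiveDomain γ ν I ⊆ I)
  exact ((contDiffOn_const (c := (2 : ℝ))).smul hγ).sub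
    (((hγ.norm_sq ℝ).div (hγ.inner ℝ hν) fun t ht => ht.2).smul hν)

theorem ne_zero_of_mem_primitiveDomain {t : ℝ} (ht : t ∈ primitiveDomain γ ν I) : γ t ≠ 0 := by
  intro h
  exact ht.2 (by simp [h])

theorem hasDerivAt_of_mem (hI : IsOpen I) (h : IsLegendrianOn γ ν I) {t : ℝ} (ht : t ∈ I) :
    HasDerivAt γ (deriv γ t) t :=
  ((h.1.differentiableOn (by simp)).differentiableAt (hI.mem_nhds ht)).hasDerivAt

theorem hasDerivAt_primitivePoint (hI : IsOpen I) (h : IsLegendrianOn γ ν I) {t : ℝ}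
    (ht : t ∈ primitiveDomain γ ν I) :
    HasDerivAt (primitivePoint γ ν) (deriv (primitivePoint γ ν) t) t :=
  (((contDiffOn_primitivePoint h).differentiableOn (by simp)).differentiableAt
    ((isOpen_primitiveDomain hI h).mem_nhds ht)).hasDerivAt

/-- The primitive is the envelope of the lines through `γ` orthogonal to `γ`. -/
theorem inner_deriv_primitivePoint (hI : IsOpen I) (h : IsLegendrianOn γ ν I) {t : ℝ}
    (ht : t ∈ primitiveDomain γ ν I) :
    inner ℝ (deriv (primitivePoint γ ν) t) (γ t) = 0 := by
  have hγ := hasDerivAt_of_mem hI h ht.1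
  have h1 := (hasDerivAt_primitivePoint hI h ht).inner ℝ hγ
  have h2 := hγ.inner ℝ hγ
  have he : (fun s => inner ℝ (primitivePoint γ ν s) (γ s)) =ᶠ[𝓝 t]
      fun s => inner ℝ (γ s) (γ s) := by
    filter_upwards [(isOpen_primitiveDomain hI h).mem_nhds ht] with s hs
    exact inner_primitivePoint_self hs.2
  have h3 := h1.unique (h2.congr_of_eventuallyEq he)
  rw [inner_primitivePoint_of_orthogonal (h.2.2 t ht.1).2,
    real_inner_comm (γ t) (deriv γ t)] at h3
  linarith

/-- A frontal whose primitive runs in a circle lies, where its primitive is regular, in the pedal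
of that circle. -/
theorem mem_zeroSet_limaconPoly_of_primitive (hI : IsOpen I) (h : IsLegendrianOn γ ν I)
    {a b r : ℝ} (hc : ∀ s ∈ primitiveDomain γ ν I, primitivePoint γ ν s ∈ circle a b r)
    {t : ℝ} (ht : t ∈ primitiveDomain γ ν I) (hreg : deriv (primitivePoint γ ν) t ≠ 0) :
    γ t ∈ zeroSet (limaconPoly a b r) := by
  have h1 := inner_deriv_primitivePoint hI h ht
  have h2 := inner_primitivePoint_self ht.2
  have h3 := mem_circle_iff.mp (hc t ht)
  have hq := (hasDerivAt_primitivePoint hI h ht).sub_const !₂[a, b]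
  have h5 := hq.inner ℝ hq
  have he : (fun s => inner ℝ (primitivePoint γ ν s - !₂[a, b])
      (primitivePoint γ ν s - !₂[a, b])) =ᶠ[𝓝 t] fun s => r ^ 2 := by
    filter_upwards [(isOpen_primitiveDomain hI h).mem_nhds ht] with s hs
    exact mem_circle_iff.mp (hc s hs)
  have h4 := h5.unique ((hasDerivAt_const t (r ^ 2)).congr_of_eventuallyEq he)
  generalize deriv (primitivePoint γ ν) t = w at *
  generalize primitivePoint γ ν t = q at *
  generalize γ t = p at *
  simp only [inner_plane, PiLp.sub_apply, Matrix.cons_val_zero, Matrix.cons_val_one,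
    Matrix.cons_val_fin_one] at h1 h2 h3 h4
  -- The nonzero vector `w` is orthogonal to both `p` and `q - (a, b)`, so these are parallel
  -- (Cramer's rule).
  have hdet : p 0 * (q 1 - b) - p 1 * (q 0 - a) = 0 := by
    by_contra hdet
    apply hreg
    have h6 : w 0 * (q 0 - a) + w 1 * (q 1 - b) = 0 := by linarith
    ext i
    fin_cases i
    · have h8 : w 0 * (p 0 * (q 1 - b) - p 1 * (q 0 - a)) = 0 := by
        linear_combination (q 1 - b) * h1 - p 1 * h6
      exact (mul_eq_zero.mp h8).resolve_right hdet
    · have h8 : w 1 * (p 0 * (q 1 - b) - p 1 * (q 0 - a)) = 0 := by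
        linear_combination -(q 0 - a) * h1 + p 0 * h6
      exact (mul_eq_zero.mp h8).resolve_right hdet
  rw [zeroSet, mem_ofPred_eq, eval_limaconPoly]
  have h7 : p 0 ^ 2 + p 1 ^ 2 - (a * p 0 + b * p 1) = (q 0 - a) * p 0 + (q 1 - b) * p 1 := by
    linear_combination -h2
  rw [h7]
  -- Lagrange's identity: squared inner product plus squared determinant is the product of the
  -- squared norms.
  linear_combination (p 0 ^ 2 + p 1 ^ 2) * h3 - (p 0 * (q 1 - b) - p 1 * (q 0 - a)) * hdet

/-- A nondegenerate curve takes infinitely many values on every nonempty open set. -/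
theorem infinite_image_of_dense_regular (hd : I ⊆ closure {s ∈ I | deriv γ s ≠ 0})
    (hc : ContinuousOn γ I) {U : Set ℝ} (hU : IsOpen U) (hUI : U ⊆ I) (hne : U.Nonempty) :
    (γ '' U).Infinite := by
  intro hfin
  obtain ⟨t, ht⟩ := hne
  obtain ⟨ε, hε, hb⟩ := Metric.isOpen_iff.mp hU t ht
  obtain ⟨s, hs, -, hs'⟩ := mem_closure_iff.mp (hd (hUI ht)) _ Metric.isOpen_ball
    (Metric.mem_ball_self hε)
  -- A finite connected image is one point, which would force `deriv γ s = 0`.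
  have hsub : (γ '' Metric.ball t ε).Subsingleton :=
    ((convex_ball t ε).isPreconnected.image γ
      (hc.mono (hb.trans hUI))).isDiscrete_iff_subsingleton.mp
      (hfin.subset (image_mono hb)).isDiscrete
  apply hs'
  have he : γ =ᶠ[𝓝 s] fun _ => γ s := by
    filter_upwards [Metric.isOpen_ball.mem_nhds hs] with x hx
    exact hsub (mem_image_of_mem γ hx) (mem_image_of_mem γ hs)
  rw [he.deriv_eq, deriv_const]

end Frontal

/-! ### Constant primitives, and the divisibility of the limaçon polynomial by `F`. -/

open MvPolynomial in
/-- The equation of the circle with diameter `[0, q]`. -/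
def diameterPoly (q : Plane) : MvPolynomial (Fin 2) ℝ :=
  X 0 ^ 2 + X 1 ^ 2 - (C (q 0) * X 0 + C (q 1) * X 1)

theorem mem_zeroSet_diameterPoly {p q : Plane} :
    p ∈ zeroSet (diameterPoly q) ↔ inner ℝ q p = inner ℝ p p := by
  simp only [zeroSet, diameterPoly, mem_ofPred_eq, inner_plane]
  simp
  constructor <;> intro h <;> linarith

/-- Two distinct circles with diameters `[0, q]` and `[0, q']` have at most one common point besides
the origin. -/
theorem subsingleton_inter_diameterPoly {q q' : Plane} (hq : q ≠ q') :
    ((zeroSet (diameterPoly q) ∩ zeroSet (diameterPoly q')) \ {0}).Subsingleton := by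
  rintro p ⟨⟨hp, hp'⟩, hp0⟩ s ⟨⟨hs, hs'⟩, hs0⟩
  rw [mem_zeroSet_diameterPoly, inner_plane, inner_plane] at hp hp' hs hs'
  have hdet : p 0 * s 1 - p 1 * s 0 = 0 := by
    by_contra hdet
    apply hq
    ext i
    fin_cases i
    · have h : (q 0 - q' 0) * (p 0 * s 1 - p 1 * s 0) = 0 := by
        linear_combination s 1 * (hp - hp') - p 1 * (hs - hs')
      exact sub_eq_zero.mp ((mul_eq_zero.mp h).resolve_right hdet)
    · have h : (q 1 - q' 1) * (p 0 * s 1 - p 1 * s 0) = 0 := by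
        linear_combination - s 0 * (hp - hp') + p 0 * (hs - hs')
      exact sub_eq_zero.mp ((mul_eq_zero.mp h).resolve_right hdet)
  have hpp : p 0 * p 0 + p 1 * p 1 ≠ 0 := by
    rw [← inner_plane]
    exact inner_self_ne_zero.mpr hp0
  have hss : s 0 * s 0 + s 1 * s 1 ≠ 0 := by
    rw [← inner_plane]
    exact inner_self_ne_zero.mpr hs0
  have h0 : p 0 * (s 0 * s 0 + s 1 * s 1) = s 0 * (p 0 * p 0 + p 1 * p 1) := by
    linear_combination q 1 * hdet + s 0 * hp - p 0 * hs
  have h1 : p 1 * (s 0 * s 0 + s 1 * s 1) = s 1 * (p 0 * p 0 + p 1 * p 1) := by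
    linear_combination -q 0 * hdet + s 1 * hp - p 1 * hs
  have hN : p 0 * p 0 + p 1 * p 1 = s 0 * s 0 + s 1 * s 1 := by
    refine mul_left_cancel₀ (mul_ne_zero hpp hss) ?_
    linear_combination -(p 0 * (s 0 * s 0 + s 1 * s 1) + s 0 * (p 0 * p 0 + p 1 * p 1)) * h0
      - (p 1 * (s 0 * s 0 + s 1 * s 1) + s 1 * (p 0 * p 0 + p 1 * p 1)) * h1
  rw [hN] at h0 h1
  ext i
  fin_cases i
  · exact mul_right_cancel₀ hss h0
  · exact mul_right_cancel₀ hss h1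

/-- If the closure of the primitive of an irreducible curve is a circle, the equation of the curve
divides the equation of the pedal of the circle. -/
theorem dvd_limaconPoly_of_primitive {F : MvPolynomial (Fin 2) ℝ} (hF : Irreducible F)
    {S : Set Plane} (hS : S ⊆ insert 0 (zeroSet F)) {a b r : ℝ} (hr : 0 < r)
    (hPr : closure (primitive S) = circle a b r) :
    F ∣ limaconPoly a b r ∧ ∃ p ∈ zeroSet F, p ≠ 0 := by
  have hmem : ∀ {γ ν : ℝ → Plane} {I : Set ℝ}, (∀ s ∈ I, γ s ∈ S) →
      γ '' primitiveDomain γ ν I ⊆ zeroSet F := by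
    rintro γ ν I h _ ⟨s, hs, rfl⟩
    exact (hS (h s hs.1)).resolve_left (ne_zero_of_mem_primitiveDomain hs)
  by_cases hex : ∃ (γ ν : ℝ → Plane) (s₁ s₂ t : ℝ), IsLegendrianOn γ ν (Ioo s₁ s₂) ∧
    Ioo s₁ s₂ ⊆ closure {s ∈ Ioo s₁ s₂ | deriv γ s ≠ 0} ∧
    (∀ s ∈ Ioo s₁ s₂, γ s ∈ S) ∧ t ∈ primitiveDomain γ ν (Ioo s₁ s₂) ∧
    deriv (primitivePoint γ ν) t ≠ 0
  · obtain ⟨γ, ν, s₁, s₂, t, hL, hd, hγ, ht, hq⟩ := hex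
    have hcirc : ∀ s ∈ primitiveDomain γ ν (Ioo s₁ s₂), primitivePoint γ ν s ∈ circle a b r := by
      intro s hs
      rw [← hPr]
      exact subset_closure ⟨γ, ν, s₁, s₂, s, hL, hd, hγ, hs.1, hs.2, rfl⟩
    have hD := isOpen_primitiveDomain isOpen_Ioo hL
    have hV : IsOpen (primitiveDomain γ ν (Ioo s₁ s₂) ∩ {s | deriv (primitivePoint γ ν) s ≠ 0}) :=
      ((contDiffOn_primitivePoint hL).continuousOn_deriv_of_isOpen hD
        (by simp)).isOpen_inter_preimage hD isOpen_ne
    have hinf := infinite_image_of_dense_regular hd hL.1.continuousOn hV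
      (inter_subset_left.trans inter_subset_left) ⟨t, ht, hq⟩
    refine ⟨dvd_of_infinite hF hinf ((image_mono inter_subset_left).trans (hmem hγ)) ?_,
      γ t, hmem hγ (mem_image_of_mem γ ht), ne_zero_of_mem_primitiveDomain ht⟩
    rintro _ ⟨s, hs, rfl⟩
    exact mem_zeroSet_limaconPoly_of_primitive isOpen_Ioo hL hcirc hs.1 hs.2
  · exfalso
    push Not at hex
    -- With no regular primitive anywhere, the primitive point is constant near `t`, so a whole arc
    -- of `γ` lies on the circle with diameter `[0, q]`.
    have key : ∀ q ∈ primitive S, F ∣ diameterPoly q ∧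
        ∃ T : Set Plane, T.Infinite ∧ T ⊆ zeroSet F \ {0} := by
      rintro q ⟨γ, ν, s₁, s₂, t, hL, hd, hγ, htI, ht, rfl⟩
      have hD := isOpen_primitiveDomain isOpen_Ioo hL
      obtain ⟨ε, hε, hb⟩ := Metric.isOpen_iff.mp hD t ⟨htI, ht⟩
      have hinf := infinite_image_of_dense_regular hd hL.1.continuousOn Metric.isOpen_ball
        (hb.trans inter_subset_left) ⟨t, Metric.mem_ball_self hε⟩
      refine ⟨dvd_of_infinite hF hinf ((image_mono hb).trans (hmem hγ)) ?_, _, hinf, ?_⟩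
      · rintro _ ⟨s, hs, rfl⟩
        have hconst : primitivePoint γ ν s = primitivePoint γ ν t := by
          refine (convex_ball t ε).is_const_of_fderivWithin_eq_zero (𝕜 := ℝ) ?_ ?_ hs
            (Metric.mem_ball_self hε)
          · exact ((contDiffOn_primitivePoint hL).differentiableOn (by simp)).mono hb
          · intro x hx
            rw [fderivWithin_of_isOpen Metric.isOpen_ball hx]
            ext1
            simpa using hex γ ν s₁ s₂ x hL hd hγ (hb hx)
        rw [mem_zeroSet_diameterPoly, ← hconst]
        exact inner_primitivePoint_self (hb hs).2
      · rintro _ ⟨s, hs, rfl⟩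
        exact ⟨hmem hγ (mem_image_of_mem γ (hb hs)), ne_zero_of_mem_primitiveDomain (hb hs)⟩
    have hsub : (primitive S).Subsingleton := by
      intro q hq q' hq'
      by_contra hne
      obtain ⟨hdvd, T, hT, hTF⟩ := key q hq
      have hzero : ∀ {G}, F ∣ G → zeroSet F ⊆ zeroSet G := by
        rintro _ ⟨H, rfl⟩ p hp
        have : MvPolynomial.eval (fun i => p i) F = 0 := hp
        simp [zeroSet, this]
      refine hT ((subsingleton_inter_diameterPoly hne).anti fun p hp => ?_).finite
      exact ⟨⟨hzero hdvd (hTF hp).1, hzero (key q' hq').1 (hTF hp).1⟩, (hTF hp).2⟩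
    have h1 : (!₂[a + r, b] : Plane) ∈ circle a b r := by simp [circle]
    have h2 : (!₂[a - r, b] : Plane) ∈ circle a b r := by simp [circle]
    rw [← hPr] at h1 h2
    have h3 := congrArg (fun p : Plane => p 0) (hsub.closure h1 h2)
    simp at h3
    linarith

/-! ### Local normal forms of the cusp and the node. -/

/-- A pair of analytic functions with independent differentials at `p` that carries the germ of `S`
at `p` to the germ of `T` is a local diffeomorphism between them. -/
theorem locallyDiffeomorphicAt_of_hasFDerivAt {g₁ g₂ : Plane → ℝ} {p : Plane}
    (hg₁ : ContDiffAt ℝ ω g₁ p) (hg₂ : ContDiffAt ℝ ω g₂ p) {L₁ L₂ : Plane →L[ℝ] ℝ}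
    (hL₁ : HasFDerivAt g₁ L₁ p) (hL₂ : HasFDerivAt g₂ L₂ p)
    (hL : ∀ w, L₁ w = 0 → L₂ w = 0 → w = 0) {S T : Set Plane}
    (hST : ∀ᶠ x in 𝓝 p, x ∈ S ↔ !₂[g₁ x, g₂ x] ∈ T) {q : Plane} (hq₁ : g₁ p = q 0)
    (hq₂ : g₂ p = q 1) : LocallyDiffeomorphicAt S p T q := by
  let f : Plane → Plane := fun x => !₂[g₁ x, g₂ x]
  have hf : ContDiffAt ℝ ω f p := by
    rw [contDiffAt_euclidean]
    intro i
    fin_cases i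
    · exact hg₁
    · exact hg₂
  let f' : Plane →L[ℝ] Plane :=
    (EuclideanSpace.equiv (Fin 2) ℝ).symm.toContinuousLinearMap.comp
      (ContinuousLinearMap.pi ![L₁, L₂])
  have hf' : HasFDerivAt f f' p := by
    rw [← hasFDerivWithinAt_univ, hasFDerivWithinAt_euclidean]
    intro i
    rw [hasFDerivWithinAt_univ]
    fin_cases i
    · exact hL₁
    · exact hL₂
  have hinj : Function.Injective f' := by
    rw [injective_iff_map_eq_zero]
    intro w hw
    exact hL w (congrFun (congrArg WithLp.ofLp hw) 0) (congrFun (congrArg WithLp.ofLp hw) 1)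
  let e : Plane ≃L[ℝ] Plane :=
    (LinearEquiv.ofInjectiveEndo (f' : Plane →ₗ[ℝ] Plane) hinj).toContinuousLinearEquiv
  have he : HasFDerivAt f (e : Plane →L[ℝ] Plane) p := by
    convert hf'
    ext1
    rfl
  have hω : (ω : WithTop ℕ∞) ≠ 0 := by simp
  let Φ₀ := hf.toOpenPartialHomeomorph f he hω
  have hp₀ : p ∈ Φ₀.source := hf.mem_toOpenPartialHomeomorph_source he hω
  let Φ₁ := Φ₀.restrContDiff ℝ ω (by simp)
  have hp₁ : p ∈ Φ₁.source := by
    -- The restricted source also requires the local inverse to be analytic at the image of `p`.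
    refine ⟨hp₀, hf, ?_⟩
    have h := hf.to_localInverse he hω
    exact h
  obtain ⟨V, hV, hVo, hpV⟩ := eventually_nhds_iff.mp hST
  let Φ := Φ₁.restrOpen V hVo
  have hsrc : Φ.source = Φ₁.source ∩ V := Φ₁.restrOpen_source V hVo
  have htgt : Φ.target ⊆ Φ₁.target := by
    intro y hy
    exact hy.1
  refine ⟨Φ, by rw [hsrc]; exact ⟨hp₁, hpV⟩, ?_, ?_, ?_, ?_⟩
  · ext i
    fin_cases i
    · exact hq₁
    · exact hq₂
  · refine ((Φ₀.contDiffOn_restrContDiff_source ℝ (by simp)).mono ?_).of_le le_top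
    rw [hsrc]
    exact inter_subset_left
  · exact ((Φ₀.contDiffOn_restrContDiff_target ℝ (by simp)).mono htgt).of_le le_top
  · ext y
    constructor
    · rintro ⟨x, ⟨hxS, hx⟩, rfl⟩
      have hxV : x ∈ V := (hsrc ▸ hx : x ∈ Φ₁.source ∩ V).2
      exact ⟨(hV x hxV).mp hxS, Φ.map_source hx⟩
    · rintro ⟨hyT, hy⟩
      have hx := Φ.map_target hy
      have hxV : Φ.symm y ∈ V := (hsrc ▸ hx : _ ∈ Φ₁.source ∩ V).2
      refine ⟨Φ.symm y, ⟨(hV _ hxV).mpr ?_, hx⟩, Φ.right_inv hy⟩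
      have : !₂[g₁ (Φ.symm y), g₂ (Φ.symm y)] = y := Φ.right_inv hy
      rwa [this]

/-- The new coordinates are built from products of a linear form with a function nonzero at the
origin; their differentials there only see the linear form. -/
theorem hasFDerivAt_mul_of_eq_zero {L : Plane →L[ℝ] ℝ} {h : Plane → ℝ} {p : Plane} (hL : L p = 0)
    (hh : DifferentiableAt ℝ h p) : HasFDerivAt (fun x => L x * h x) (h p • L) p := by
  have := L.hasFDerivAt (x := p) |>.mul hh.hasFDerivAt
  rw [hL, zero_smul, zero_add] at this
  exact this

/-- An orthonormal frame of the plane whose second vector points to the centre `(a, b)`. -/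
theorem exists_frame (a b : ℝ) : ∃ (u v : Plane) (d : ℝ), Orthonormal ℝ ![u, v] ∧ 0 ≤ d ∧
    d ^ 2 = a ^ 2 + b ^ 2 ∧ (∀ p : Plane, a * p 0 + b * p 1 = d * inner ℝ v p) ∧
    ∀ p : Plane, p 0 ^ 2 + p 1 ^ 2 = inner ℝ u p ^ 2 + inner ℝ v p ^ 2 := by
  obtain ⟨c, s, d, h1, hd, rfl, rfl⟩ : ∃ c s d : ℝ, c ^ 2 + s ^ 2 = 1 ∧ 0 ≤ d ∧
      a = d * c ∧ b = d * s := by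
    refine ⟨Real.cos (Complex.arg ⟨a, b⟩), Real.sin (Complex.arg ⟨a, b⟩), ‖(⟨a, b⟩ : ℂ)‖,
      Real.cos_sq_add_sin_sq _, norm_nonneg _, ?_, ?_⟩
    · rw [Complex.norm_mul_cos_arg]
    · rw [Complex.norm_mul_sin_arg]
  refine ⟨!₂[-s, c], !₂[c, s], d, ?_, hd, by linear_combination -d ^ 2 * h1, fun p => ?_,
    fun p => ?_⟩
  · rw [orthonormal_iff_ite]
    intro i j
    rw [inner_plane]
    fin_cases i <;> fin_cases j <;> simp
    · linear_combination h1
    · ring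
    · ring
    · linear_combination h1
  · simp [inner_plane]
    ring
  · simp [inner_plane]
    linear_combination -(p 0 ^ 2 + p 1 ^ 2) * h1

section Frame

variable {a b r d : ℝ} {u v : Plane}

theorem mem_zeroSet_limaconPoly {p : Plane} : p ∈ zeroSet (limaconPoly a b r) ↔
    (p 0 ^ 2 + p 1 ^ 2 - (a * p 0 + b * p 1)) ^ 2 = r ^ 2 * (p 0 ^ 2 + p 1 ^ 2) := by
  rw [zeroSet, mem_ofPred_eq, eval_limaconPoly, sub_eq_zero]

theorem eq_zero_of_inner_frame
    (hN : ∀ p : Plane, p 0 ^ 2 + p 1 ^ 2 = inner ℝ u p ^ 2 + inner ℝ v p ^ 2)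
    {w : Plane} (h1 : inner ℝ u w = 0) (h2 : inner ℝ v w = 0) : w = 0 := by
  rw [← norm_eq_zero, ← sq_eq_zero_iff, norm_sq_plane, hN, h1, h2]
  ring

theorem mem_range_cusp {p : Plane} :
    p ∈ range (fun t : ℝ => (!₂[t ^ 2, t ^ 3] : Plane)) ↔ p 1 ^ 2 = p 0 ^ 3 := by
  constructor
  · rintro ⟨t, rfl⟩
    simp
    ring
  · intro h
    by_cases h0 : p 0 = 0
    · refine ⟨0, ?_⟩
      have h1 : p 1 = 0 := by simpa [h0] using h
      ext i
      fin_cases i <;> simp [h0, h1]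
    · refine ⟨p 1 / p 0, ?_⟩
      ext i
      fin_cases i
      · simp
        field_simp
        linear_combination h
      · simp
        field_simp
        linear_combination p 1 * h

/-- For `d = r` the equation reads `x²(d² + 2dy - 2y² - x²) = -y³(2d - y)`. Absorbing a square root
into `x` and a cube root into `y` turns it into `X² = Y³`. -/
theorem hasOrdinaryCuspAt_limacon (hr : 0 < r) (h : a ^ 2 + b ^ 2 = r ^ 2) :
    HasOrdinaryCuspAt (zeroSet (limaconPoly a b r)) 0 := by
  obtain ⟨u, v, d, -, hd, hd2, hv, hN⟩ := exists_frame a b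
  obtain rfl : d = r := by nlinarith
  let x : Plane →L[ℝ] ℝ := innerSL ℝ u
  let y : Plane →L[ℝ] ℝ := innerSL ℝ v
  let h₁ : Plane → ℝ := fun p => -(2 * d - y p) ^ (1 / 3 : ℝ)
  let h₂ : Plane → ℝ := fun p => √(d ^ 2 + 2 * d * y p - 2 * y p ^ 2 - x p ^ 2)
  have hh₁ : ContDiffAt ℝ ω h₁ 0 := by
    refine ((contDiffAt_const.sub y.contDiff.contDiffAt).rpow_const_of_ne ?_).neg
    simp [hr.ne']
  have hc : Continuous fun p => d ^ 2 + 2 * d * y p - 2 * y p ^ 2 - x p ^ 2 := by fun_prop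
  have hh₂ : ContDiffAt ℝ ω h₂ 0 := by
    refine ContDiffAt.sqrt ?_ ?_
    · exact ContDiff.contDiffAt (by fun_prop)
    · simp [hr.ne']
  have hω : (ω : WithTop ℕ∞) ≠ 0 := by simp
  refine locallyDiffeomorphicAt_of_hasFDerivAt (S := zeroSet (limaconPoly a b d))
    (T := range (fun t : ℝ => (!₂[t ^ 2, t ^ 3] : Plane)))
    (y.contDiff.contDiffAt.mul hh₁) (x.contDiff.contDiffAt.mul hh₂)
    (hasFDerivAt_mul_of_eq_zero (map_zero y) (hh₁.differentiableAt hω))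
    (hasFDerivAt_mul_of_eq_zero (map_zero x) (hh₂.differentiableAt hω)) ?_ ?_ (by simp) (by simp)
  · intro w hw1 hw2
    have h₁0 : h₁ 0 ≠ 0 := by
      simpa [h₁] using (Real.rpow_pos_of_pos (mul_pos two_pos hr) _).ne'
    have h₂0 : h₂ 0 ≠ 0 := by simp [h₂, Real.sqrt_sq hr.le, hr.ne']
    exact eq_zero_of_inner_frame hN ((mul_eq_zero.mp hw2).resolve_left h₂0)
      ((mul_eq_zero.mp hw1).resolve_left h₁0)
  · have e1 : ∀ᶠ p in 𝓝 (0 : Plane), 0 < 2 * d - y p :=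
      continuousAt_const.eventually_lt (f := fun _ => (0 : ℝ)) (by fun_prop) (by simpa using hr)
    have e2 : ∀ᶠ p in 𝓝 (0 : Plane), 0 < d ^ 2 + 2 * d * y p - 2 * y p ^ 2 - x p ^ 2 :=
      continuousAt_const.eventually_lt hc.continuousAt (by simpa using pow_pos hr 2)
    filter_upwards [e1, e2] with p hp1 hp2
    have h₁3 : h₁ p ^ 3 = -(2 * d - y p) := by
      have : ((2 * d - y p) ^ (1 / 3 : ℝ)) ^ 3 = 2 * d - y p := by
        rw [← Real.rpow_natCast, ← Real.rpow_mul hp1.le]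
        norm_num
      simp only [h₁]
      linear_combination -this
    have h₂2 : h₂ p ^ 2 = _ := Real.sq_sqrt hp2.le
    rw [mem_range_cusp, mem_zeroSet_limaconPoly, hv, hN]
    change (x p ^ 2 + y p ^ 2 - d * y p) ^ 2 = d ^ 2 * (x p ^ 2 + y p ^ 2) ↔
      (x p * h₂ p) ^ 2 = (y p * h₁ p) ^ 3
    rw [mul_pow, mul_pow, h₁3, h₂2]
    constructor <;> intro h <;> linear_combination -h

/-- The polynomial equals `y²k₁ - x²k₂` with `k₁`, `k₂` positive at the origin, so near there it
factors as a difference of squares; the two factors are the new coordinates. -/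
theorem hasNodeAt_limacon (hr : 0 < r) (h : r ^ 2 < a ^ 2 + b ^ 2) :
    HasNodeAt (zeroSet (limaconPoly a b r)) 0 := by
  obtain ⟨u, v, d, -, hd, hd2, hv, hN⟩ := exists_frame a b
  let x : Plane →L[ℝ] ℝ := innerSL ℝ u
  let y : Plane →L[ℝ] ℝ := innerSL ℝ v
  let k₁ : Plane → ℝ := fun p => d ^ 2 - r ^ 2 + (x p ^ 2 + y p ^ 2) - 2 * d * y p
  let k₂ : Plane → ℝ := fun p => r ^ 2 - (x p ^ 2 + y p ^ 2) + 2 * d * y p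
  have hk₁ : ContDiff ℝ ω k₁ := by fun_prop
  have hk₂ : ContDiff ℝ ω k₂ := by fun_prop
  have hk₁0 : 0 < k₁ 0 := by simp [k₁]; linarith
  have hk₂0 : 0 < k₂ 0 := by simp [k₂]; positivity
  let h₁ : Plane → ℝ := fun p => √(k₁ p)
  let h₂ : Plane → ℝ := fun p => √(k₂ p)
  have hh₁ : ContDiffAt ℝ ω h₁ 0 := hk₁.contDiffAt.sqrt hk₁0.ne'
  have hh₂ : ContDiffAt ℝ ω h₂ 0 := hk₂.contDiffAt.sqrt hk₂0.ne'
  have hω : (ω : WithTop ℕ∞) ≠ 0 := by simp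
  have hA := y.contDiff.contDiffAt.mul hh₁
  have hB := x.contDiff.contDiffAt.mul hh₂
  have hA' := hasFDerivAt_mul_of_eq_zero (map_zero y) (hh₁.differentiableAt hω)
  have hB' := hasFDerivAt_mul_of_eq_zero (map_zero x) (hh₂.differentiableAt hω)
  refine locallyDiffeomorphicAt_of_hasFDerivAt (S := zeroSet (limaconPoly a b r))
    (T := {z | z 0 * z 1 = 0}) (hA.sub hB) (hA.add hB) (hA'.sub hB') (hA'.add hB') ?_ ?_
    (by simp) (by simp)
  · intro w hw1 hw2
    have h₁0 : h₁ 0 ≠ 0 := (Real.sqrt_pos.mpr hk₁0).ne'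
    have h₂0 : h₂ 0 ≠ 0 := (Real.sqrt_pos.mpr hk₂0).ne'
    have hw1 : h₁ 0 * y w - h₂ 0 * x w = 0 := hw1
    have hw2 : h₁ 0 * y w + h₂ 0 * x w = 0 := hw2
    refine eq_zero_of_inner_frame hN ((mul_eq_zero.mp (?_ : h₂ 0 * x w = 0)).resolve_left h₂0)
      ((mul_eq_zero.mp (?_ : h₁ 0 * y w = 0)).resolve_left h₁0) <;> linarith
  · filter_upwards [hk₁.continuous.continuousAt.eventually (lt_mem_nhds hk₁0),
      hk₂.continuous.continuousAt.eventually (lt_mem_nhds hk₂0)] with p hp1 hp2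
    have h₁2 : h₁ p ^ 2 = _ := Real.sq_sqrt hp1.le
    have h₂2 : h₂ p ^ 2 = _ := Real.sq_sqrt hp2.le
    rw [mem_zeroSet_limaconPoly, hv, hN]
    change (x p ^ 2 + y p ^ 2 - d * y p) ^ 2 = r ^ 2 * (x p ^ 2 + y p ^ 2) ↔
      (y p * h₁ p - x p * h₂ p) * (y p * h₁ p + x p * h₂ p) = 0
    have hid : (y p * h₁ p - x p * h₂ p) * (y p * h₁ p + x p * h₂ p)
        = (x p ^ 2 + y p ^ 2 - d * y p) ^ 2 - r ^ 2 * (x p ^ 2 + y p ^ 2) := by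
      linear_combination y p ^ 2 * h₁2 - x p ^ 2 * h₂2
    rw [hid, sub_eq_zero]

/-- In the frame pointing to the centre, the conic is given by a focus and a directrix. -/
theorem mem_invConic_iff
    (hv : ∀ p : Plane, a * p 0 + b * p 1 = d * inner ℝ v p)
    (hN : ∀ p : Plane, p 0 ^ 2 + p 1 ^ 2 = inner ℝ u p ^ 2 + inner ℝ v p ^ 2) {p : Plane} :
    p ∈ invConic a b r ↔
      r ^ 2 * inner ℝ u p ^ 2 + (r ^ 2 - d ^ 2) * inner ℝ v p ^ 2 + 2 * d * inner ℝ v p = 1 := by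
  have h : (r ^ 2 - a ^ 2) * p 0 ^ 2 + (r ^ 2 - b ^ 2) * p 1 ^ 2 - 2 * a * b * p 0 * p 1
      + 2 * (a * p 0 + b * p 1) - 1
      = r ^ 2 * inner ℝ u p ^ 2 + (r ^ 2 - d ^ 2) * inner ℝ v p ^ 2 + 2 * d * inner ℝ v p - 1 := by
    linear_combination r ^ 2 * hN p - (a * p 0 + b * p 1 + d * inner ℝ v p - 2) * hv p
  rw [invConic, mem_ofPred_eq, h, sub_eq_zero]

theorem inner_sub_smul_frame (huv : Orthonormal ℝ ![u, v]) (k : ℝ) (p : Plane) :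
    inner ℝ u (p - k • v) = inner ℝ u p ∧ inner ℝ v (p - k • v) = inner ℝ v p - k := by
  rw [orthonormal_iff_ite] at huv
  have h1 : inner ℝ u v = 0 := by simpa using huv 0 1
  have h2 : inner ℝ v v = (1 : ℝ) := by simpa using huv 1 1
  simp only [inner_sub_right, real_inner_smul_right, h1, h2]
  constructor <;> ring

theorem isParabola_invConic (hr : 0 < r) (h : a ^ 2 + b ^ 2 = r ^ 2) :
    IsParabola (invConic a b r) := by
  obtain ⟨u, v, d, huv, hd, hd2, hv, hN⟩ := exists_frame a b
  obtain rfl : d = r := by nlinarith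
  refine ⟨(1 / (2 * d)) • v, u, v, -d / 2, huv, by simp [hr.ne'], ?_⟩
  ext p
  obtain ⟨h1, h2⟩ := inner_sub_smul_frame huv (1 / (2 * d)) p
  rw [mem_invConic_iff hv hN, mem_ofPred_eq, h1, h2]
  field_simp
  constructor <;> intro h <;> linear_combination h

theorem isEllipse_invConic (hr : 0 < r) (h : a ^ 2 + b ^ 2 < r ^ 2) :
    IsEllipse (invConic a b r) := by
  obtain ⟨u, v, d, huv, hd, hd2, hv, hN⟩ := exists_frame a b
  have hk : 0 < r ^ 2 - d ^ 2 := by linarith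
  -- With `k = r² - d²`, completing the square gives `r²x² + k(y + d/k)² = r²/k`.
  refine ⟨(-d / (r ^ 2 - d ^ 2)) • v, u, v, 1 / √(r ^ 2 - d ^ 2), r / (r ^ 2 - d ^ 2), huv,
    by positivity, by positivity, ?_⟩
  ext p
  obtain ⟨h1, h2⟩ := inner_sub_smul_frame huv (-d / (r ^ 2 - d ^ 2)) p
  rw [mem_invConic_iff hv hN, mem_ofPred_eq, h1, h2, div_pow, div_pow, div_pow,
    Real.sq_sqrt hk.le]
  field_simp
  constructor <;> intro h
  · linear_combination (r ^ 2 - d ^ 2) * h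
  · refine mul_left_cancel₀ hk.ne' ?_
    linear_combination h

theorem isHyperbola_invConic (hr : 0 < r) (h : r ^ 2 < a ^ 2 + b ^ 2) :
    IsHyperbola (invConic a b r) := by
  obtain ⟨u, v, d, huv, hd, hd2, hv, hN⟩ := exists_frame a b
  have hk : 0 < d ^ 2 - r ^ 2 := by linarith
  have hvu : Orthonormal ℝ ![v, u] := by
    have := huv.comp _ (Equiv.swap (0 : Fin 2) 1).injective
    convert this using 1
    ext i
    fin_cases i <;> rfl
  -- With `k = d² - r²`, the equation is `k(y - d/k)² - r²x² = r²/k`; the transverse axis is along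
  -- `v`, hence the swapped frame.
  refine ⟨(d / (d ^ 2 - r ^ 2)) • v, v, u, r / (d ^ 2 - r ^ 2), 1 / √(d ^ 2 - r ^ 2), hvu,
    by positivity, by positivity, ?_⟩
  ext p
  obtain ⟨h1, h2⟩ := inner_sub_smul_frame huv (d / (d ^ 2 - r ^ 2)) p
  rw [mem_invConic_iff hv hN, mem_ofPred_eq, h1, h2, div_pow, div_pow, div_pow,
    div_pow, Real.sq_sqrt hk.le]
  field_simp
  constructor <;> intro h
  · linear_combination -(d ^ 2 - r ^ 2) * h
  · refine mul_left_cancel₀ hk.ne' ?_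
    linear_combination -h

end Frame

/-! ### The polar parametrization of the limaçon. -/

variable {a b r : ℝ}

/-- The distance function `r + a cos θ + b sin θ` of the limaçon in polar coordinates. -/
def polarRadius (a b r θ : ℝ) : ℝ := r + a * Real.cos θ + b * Real.sin θ

theorem limacon_mem_zeroSet (a b r θ : ℝ) : limacon a b r θ ∈ zeroSet (limaconPoly a b r) := by
  rw [mem_zeroSet_limaconPoly]
  simp only [limacon, Matrix.cons_val_zero, Matrix.cons_val_one, Matrix.cons_val_fin_one]
  have h := Real.cos_sq_add_sin_sq θ
  generalize Real.cos θ = c at *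
  generalize Real.sin θ = s at *
  have h1 : ((r + a * c + b * s) * c) ^ 2 + ((r + a * c + b * s) * s) ^ 2
      = (r + a * c + b * s) ^ 2 := by linear_combination (r + a * c + b * s) ^ 2 * h
  rw [h1]
  ring

theorem norm_sq_limacon (a b r θ : ℝ) : ‖limacon a b r θ‖ ^ 2 = polarRadius a b r θ ^ 2 := by
  rw [norm_sq_plane]
  simp only [limacon, polarRadius, Matrix.cons_val_zero, Matrix.cons_val_one,
    Matrix.cons_val_fin_one]
  linear_combination (r + a * Real.cos θ + b * Real.sin θ) ^ 2 * Real.cos_sq_add_sin_sq θ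

theorem limacon_eq_zero_iff {θ : ℝ} : limacon a b r θ = 0 ↔ polarRadius a b r θ = 0 := by
  rw [← norm_eq_zero, ← sq_eq_zero_iff, norm_sq_limacon, sq_eq_zero_iff]

theorem mem_range_limacon {p : Plane} (hp : p ∈ zeroSet (limaconPoly a b r)) (hp0 : p ≠ 0) :
    p ∈ range (limacon a b r) := by
  obtain ⟨θ, ρ, hρ, h0, h1⟩ : ∃ θ ρ : ℝ, 0 < ρ ∧ p 0 = ρ * Real.cos θ ∧ p 1 = ρ * Real.sin θ := by
    refine ⟨Complex.arg ⟨p 0, p 1⟩, ‖(⟨p 0, p 1⟩ : ℂ)‖, ?_, ?_, ?_⟩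
    · rw [norm_pos_iff]
      intro h
      apply hp0
      ext i
      fin_cases i
      · exact congrArg Complex.re h
      · exact congrArg Complex.im h
    · rw [Complex.norm_mul_cos_arg]
    · rw [Complex.norm_mul_sin_arg]
  rw [mem_zeroSet_limaconPoly, h0, h1] at hp
  have h := Real.cos_sq_add_sin_sq θ
  have h2 : (ρ - (a * Real.cos θ + b * Real.sin θ)) ^ 2 = r ^ 2 := by
    refine mul_left_cancel₀ (pow_ne_zero 2 hρ.ne') ?_
    have h3 : (ρ * Real.cos θ) ^ 2 + (ρ * Real.sin θ) ^ 2 = ρ ^ 2 := by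
      linear_combination ρ ^ 2 * h
    rw [h3] at hp
    linear_combination hp
  rcases sq_eq_sq_iff_eq_or_eq_neg.mp h2 with h2 | h2
  · refine ⟨θ, ?_⟩
    ext i
    fin_cases i
    · simp [limacon, h0]
      left; linarith
    · simp [limacon, h1]
      left; linarith
  -- The sign `-r` is the same point seen with negative polar radius from the opposite direction.
  · refine ⟨θ + Real.pi, ?_⟩
    ext i
    fin_cases i
    · simp [limacon, h0, Real.cos_add_pi, Real.sin_add_pi]
      linear_combination -Real.cos θ * h2
    · simp [limacon, h1, Real.cos_add_pi, Real.sin_add_pi]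
      linear_combination -Real.sin θ * h2

/-- In the direction of the centre and in the opposite one the polar radius is `r + d` and `r - d ≤
0`; the intermediate value theorem gives a zero. -/
theorem zero_mem_range_limacon (hr : 0 < r) (h : r ^ 2 ≤ a ^ 2 + b ^ 2) :
    (0 : Plane) ∈ range (limacon a b r) := by
  simp only [mem_range, limacon_eq_zero_iff]
  have hcont : Continuous (polarRadius a b r) := by unfold polarRadius; fun_prop
  let α := Complex.arg ⟨a, b⟩
  let d := ‖(⟨a, b⟩ : ℂ)‖
  have ha : a = d * Real.cos α := (Complex.norm_mul_cos_arg ⟨a, b⟩).symm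
  have hb : b = d * Real.sin α := (Complex.norm_mul_sin_arg ⟨a, b⟩).symm
  have hα := Real.cos_sq_add_sin_sq α
  have hd : r ≤ d := by
    refine abs_le_of_sq_le_sq' ?_ (norm_nonneg _) |>.2
    calc r ^ 2 ≤ a ^ 2 + b ^ 2 := h
      _ = d ^ 2 := by rw [ha, hb]; linear_combination d ^ 2 * hα
  have h1 : polarRadius a b r α = r + d := by
    rw [polarRadius, ha, hb]
    linear_combination d * hα
  have h2 : polarRadius a b r (α + Real.pi) = r - d := by
    rw [polarRadius, ha, hb, Real.cos_add_pi, Real.sin_add_pi]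
    linear_combination -d * hα
  exact mem_range_of_exists_le_of_exists_ge hcont ⟨α + Real.pi, by linarith⟩ ⟨α, by linarith⟩

theorem polarRadius_ne_zero (h : a ^ 2 + b ^ 2 < r ^ 2) (θ : ℝ) : polarRadius a b r θ ≠ 0 := by
  intro h0
  rw [polarRadius] at h0
  have h1 := Real.cos_sq_add_sin_sq θ
  have h2 : r ^ 2 = (a * Real.cos θ + b * Real.sin θ) ^ 2 := by
    linear_combination (r - (a * Real.cos θ + b * Real.sin θ)) * h0
  nlinarith [sq_nonneg (a * Real.sin θ - b * Real.cos θ)]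

/-- The velocity of the limaçon. -/
def limaconVelocity (a b r θ : ℝ) : Plane :=
  !₂[(-a * Real.sin θ + b * Real.cos θ) * Real.cos θ - polarRadius a b r θ * Real.sin θ,
     (-a * Real.sin θ + b * Real.cos θ) * Real.sin θ + polarRadius a b r θ * Real.cos θ]

theorem hasDerivAt_limacon (a b r θ : ℝ) :
    HasDerivAt (limacon a b r) (limaconVelocity a b r θ) θ := by
  have hρ : HasDerivAt (fun θ => r + a * Real.cos θ + b * Real.sin θ)
      (-a * Real.sin θ + b * Real.cos θ) θ := by
    have := (((Real.hasDerivAt_cos θ).const_mul a).const_add r).add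
      ((Real.hasDerivAt_sin θ).const_mul b)
    exact this.congr_deriv (by ring)
  have h : HasDerivAt (fun θ => ![(r + a * Real.cos θ + b * Real.sin θ) * Real.cos θ,
      (r + a * Real.cos θ + b * Real.sin θ) * Real.sin θ]) (limaconVelocity a b r θ).ofLp θ := by
    rw [hasDerivAt_pi]
    intro i
    fin_cases i
    · refine (hρ.mul (Real.hasDerivAt_cos θ)).congr_deriv ?_
      simp [limaconVelocity, polarRadius]
      ring
    · refine (hρ.mul (Real.hasDerivAt_sin θ)).congr_deriv ?_
      simp [limaconVelocity, polarRadius]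
  exact (EuclideanSpace.equiv (Fin 2) ℝ).symm.hasFDerivAt.comp_hasDerivAt θ h

theorem norm_sq_limaconVelocity (a b r θ : ℝ) : ‖limaconVelocity a b r θ‖ ^ 2
    = (-a * Real.sin θ + b * Real.cos θ) ^ 2 + polarRadius a b r θ ^ 2 := by
  rw [norm_sq_plane]
  simp only [limaconVelocity, Matrix.cons_val_zero, Matrix.cons_val_one, Matrix.cons_val_fin_one]
  linear_combination ((-a * Real.sin θ + b * Real.cos θ) ^ 2 + polarRadius a b r θ ^ 2)
    * Real.cos_sq_add_sin_sq θ

/-- The squared speed is `ρ'² + ρ²`. If both terms vanish, `(a, b)` has components `-r` and `0` in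
the rotated frame, so its length is `r`. -/
theorem limaconVelocity_ne_zero (h : a ^ 2 + b ^ 2 ≠ r ^ 2) (θ : ℝ) :
    limaconVelocity a b r θ ≠ 0 := by
  intro h0
  have h1 := norm_sq_limaconVelocity a b r θ
  rw [h0, norm_zero, zero_pow two_ne_zero] at h1
  have h2 : -a * Real.sin θ + b * Real.cos θ = 0 := by nlinarith
  have h3 : polarRadius a b r θ = 0 := by nlinarith
  rw [polarRadius] at h3
  apply h
  linear_combination -(a ^ 2 + b ^ 2) * Real.cos_sq_add_sin_sq θ
    + (-a * Real.sin θ + b * Real.cos θ) * h2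
    - (r - (a * Real.cos θ + b * Real.sin θ)) * h3

theorem isFrontOn_limacon (h : a ^ 2 + b ^ 2 ≠ r ^ 2) : IsFrontOn (limacon a b r) univ := by
  have hd : deriv (limacon a b r) = limaconVelocity a b r :=
    funext fun θ => (hasDerivAt_limacon a b r θ).deriv
  have hv : ContDiff ℝ ∞ (limaconVelocity a b r) := by
    rw [contDiff_euclidean]
    intro i
    fin_cases i
    · simp [limaconVelocity, polarRadius]
      fun_prop
    · simp [limaconVelocity, polarRadius]
      fun_prop
  have hγ : ContDiff ℝ ∞ (limacon a b r) := by
    rw [contDiff_euclidean]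
    intro i
    fin_cases i
    · simp [limacon]
      fun_prop
    · simp [limacon]
      fun_prop
  have hn : ∀ θ, ‖limaconVelocity a b r θ‖ ≠ 0 := fun θ =>
    norm_ne_zero_iff.mpr (limaconVelocity_ne_zero h θ)
  refine ⟨fun θ => ‖limaconVelocity a b r θ‖⁻¹ •
    !₂[-limaconVelocity a b r θ 1, limaconVelocity a b r θ 0], ⟨hγ.contDiffOn, ?_, ?_⟩, ?_⟩
  · refine ContDiff.contDiffOn (((hv.norm ℝ fun θ => limaconVelocity_ne_zero h θ).inv hn).smul ?_)
    rw [contDiff_euclidean] at hv ⊢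
    intro i
    fin_cases i
    · exact (hv 1).neg
    · exact hv 0
  · intro θ _
    rw [hd]
    constructor
    · have h1 : ‖(!₂[-limaconVelocity a b r θ 1, limaconVelocity a b r θ 0] : Plane)‖
          = ‖limaconVelocity a b r θ‖ := by
        rw [← sq_eq_sq₀ (norm_nonneg _) (norm_nonneg _), norm_sq_plane, norm_sq_plane]
        simp
        ring
      rw [norm_smul, h1, norm_inv, norm_norm, inv_mul_cancel₀ (hn θ)]
    · rw [real_inner_smul_right, inner_plane]
      simp
      right; ring
  · intro θ _
    left
    rw [hd]
    exact limaconVelocity_ne_zero h θ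

/-! ### Inversion and the conic. -/

theorem inversion_apply_plane (p : Plane) :
    EuclideanGeometry.inversion (0 : Plane) 1 p = (‖p‖ ^ 2)⁻¹ • p := by
  simp [EuclideanGeometry.inversion]

theorem inversion_mem_zeroSet_iff {p : Plane} (hp : p ≠ 0) :
    EuclideanGeometry.inversion (0 : Plane) 1 p ∈ zeroSet (limaconPoly a b r) ↔
      p ∈ invConic a b r := by
  have hN : p 0 ^ 2 + p 1 ^ 2 ≠ 0 := by
    rw [← norm_sq_plane]
    exact pow_ne_zero 2 (norm_ne_zero_iff.mpr hp)
  rw [inversion_apply_plane, norm_sq_plane, mem_zeroSet_limaconPoly, invConic, mem_ofPred_eq]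
  simp only [PiLp.smul_apply, smul_eq_mul]
  field_simp
  constructor <;> intro h <;> linear_combination -h

theorem zero_notMem_invConic : (0 : Plane) ∉ invConic a b r := by
  simp [invConic]

theorem inversionImage_eq_invConic {S : Set Plane}
    (hS : S \ {0} = zeroSet (limaconPoly a b r) \ {0}) : inversionImage S = invConic a b r := by
  have hinv := EuclideanGeometry.inversion_inversion (0 : Plane) one_ne_zero
  have hzero : ∀ p : Plane, EuclideanGeometry.inversion (0 : Plane) 1 p = 0 ↔ p = 0 :=
    fun p => EuclideanGeometry.inversion_eq_center one_ne_zero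
  rw [inversionImage, hS]
  ext p
  constructor
  · rintro ⟨q, ⟨hq, hq0⟩, rfl⟩
    rw [← inversion_mem_zeroSet_iff ((hzero q).not.mpr hq0), hinv]
    exact hq
  · intro hp
    have hp0 : p ≠ 0 := fun h => zero_notMem_invConic (h ▸ hp)
    exact ⟨_, ⟨(inversion_mem_zeroSet_iff hp0).mpr hp, (hzero p).not.mpr hp0⟩, hinv p⟩

/-- The conic contains no line. -/
theorem not_isLine_subset_invConic (hr : 0 < r) {L : Set Plane} (hL : IsLine L) :
    ¬ L ⊆ invConic a b r := by
  rintro hsub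
  obtain ⟨q, w, hw, rfl⟩ := hL
  have h : ∀ t : ℝ, r ^ 2 * ((q 0 + t * w 0) ^ 2 + (q 1 + t * w 1) ^ 2)
      = (1 - (a * (q 0 + t * w 0) + b * (q 1 + t * w 1))) ^ 2 := by
    intro t
    have := hsub (mem_range_self t)
    simp only [invConic, mem_ofPred_eq, PiLp.add_apply, PiLp.smul_apply, smul_eq_mul] at this
    linear_combination this
  have h0 := h 0
  have h1 := h 1
  have h2 := h (-1)
  have hN : w 0 ^ 2 + w 1 ^ 2 ≠ 0 := by
    rw [← norm_sq_plane]
    exact pow_ne_zero 2 (norm_ne_zero_iff.mpr hw)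
  have e0 : r ^ 2 * (q 0 ^ 2 + q 1 ^ 2) = (1 - (a * q 0 + b * q 1)) ^ 2 := by
    linear_combination h0
  have e1 : r ^ 2 * (q 0 * w 0 + q 1 * w 1)
      = -(1 - (a * q 0 + b * q 1)) * (a * w 0 + b * w 1) := by
    linear_combination (h1 - h2) / 4
  have e2 : r ^ 2 * (w 0 ^ 2 + w 1 ^ 2) = (a * w 0 + b * w 1) ^ 2 := by
    linear_combination (h1 + h2) / 2 - h0
  -- The three coefficients in `t` make `r²` times the Gram matrix of `q`, `w` of rank one, so `q`
  -- and `w` are parallel and the line passes through the origin, which is not on the conic.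
  have hdet : q 0 * w 1 - q 1 * w 0 = 0 := by
    have : (r ^ 2) ^ 2 * (q 0 * w 1 - q 1 * w 0) ^ 2 = 0 := by
      linear_combination r ^ 2 * (w 0 ^ 2 + w 1 ^ 2) * e0
        + (1 - (a * q 0 + b * q 1)) ^ 2 * e2
        - (r ^ 2 * (q 0 * w 0 + q 1 * w 1)
          - (1 - (a * q 0 + b * q 1)) * (a * w 0 + b * w 1)) * e1
    have hr4 : (r ^ 2) ^ 2 ≠ 0 := by positivity
    exact pow_eq_zero_iff two_ne_zero |>.mp ((mul_eq_zero.mp this).resolve_left hr4)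
  refine zero_notMem_invConic (hsub ⟨-(q 0 * w 0 + q 1 * w 1) / (w 0 ^ 2 + w 1 ^ 2), ?_⟩)
  ext i
  fin_cases i
  · simp
    field_simp
    linear_combination w 1 * hdet
  · simp
    field_simp
    linear_combination -w 0 * hdet

theorem isIrreducibleQuadraticCurve_invConic (hr : 0 < r) :
    IsIrreducibleQuadraticCurve (invConic a b r) := by
  constructor
  · refine ⟨r ^ 2 - a ^ 2, r ^ 2 - b ^ 2, -(a * b), a, b, -1, ?_, ?_, ?_⟩
    · by_contra! h
      obtain ⟨h1, h2, h3⟩ := h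
      have h4 : r ^ 2 * r ^ 2 = 0 := by
        linear_combination r ^ 2 * h1 + a ^ 2 * h2 - a * b * h3
      have : 0 < r ^ 2 * r ^ 2 := by positivity
      linarith
    · have : Matrix.det !![r ^ 2 - a ^ 2, -(a * b), a; -(a * b), r ^ 2 - b ^ 2, b; a, b, -1]
          = -(r ^ 2 * r ^ 2) := by
        rw [Matrix.det_fin_three]
        simp
        ring
      rw [this]
      have : 0 < r ^ 2 * r ^ 2 := by positivity
      linarith
    · ext p
      simp only [invConic, mem_ofPred_eq]
      constructor <;> intro h <;> linear_combination h
  · rintro ⟨L₁, L₂, hL₁, -, h⟩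
    exact not_isLine_subset_invConic hr hL₁ (h ▸ subset_union_left)

/-! ### Singular points of the limaçon polynomial. -/

theorem eval_pderiv_zero_limaconPoly (p : Plane) :
    MvPolynomial.eval (fun i => p i) (MvPolynomial.pderiv 0 (limaconPoly a b r))
      = 2 * (p 0 ^ 2 + p 1 ^ 2 - (a * p 0 + b * p 1)) * (2 * p 0 - a) - 2 * r ^ 2 * p 0 := by
  have h : MvPolynomial.pderiv (R := ℝ) (0 : Fin 2) 2 = 0 := by
    rw [← map_ofNat MvPolynomial.C 2, MvPolynomial.pderiv_C]
  simp [limaconPoly, MvPolynomial.pderiv_X, Derivation.leibniz, Derivation.leibniz_pow, h]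
  ring

theorem eval_pderiv_one_limaconPoly (p : Plane) :
    MvPolynomial.eval (fun i => p i) (MvPolynomial.pderiv 1 (limaconPoly a b r))
      = 2 * (p 0 ^ 2 + p 1 ^ 2 - (a * p 0 + b * p 1)) * (2 * p 1 - b) - 2 * r ^ 2 * p 1 := by
  have h : MvPolynomial.pderiv (R := ℝ) (1 : Fin 2) 2 = 0 := by
    rw [← map_ofNat MvPolynomial.C 2, MvPolynomial.pderiv_C]
  simp [limaconPoly, MvPolynomial.pderiv_X, Derivation.leibniz, Derivation.leibniz_pow, h]
  ring

/-- With `N = |p|²` and `T = N - ⟨c, p⟩`, one has `⟨p, ∇Q⟩/2 - Q = TN`. A singular zero has `T = 0`,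
and then `Q = 0` says `r²N = 0`. -/
theorem isNonsingularAt_limaconPoly (hr : 0 < r) {p : Plane}
    (hp : p ∈ zeroSet (limaconPoly a b r)) (hp0 : p ≠ 0) :
    IsNonsingularAt (limaconPoly a b r) p := by
  by_contra h
  simp only [IsNonsingularAt, not_exists, not_not] at h
  have h0 := h 0
  have h1 := h 1
  rw [eval_pderiv_zero_limaconPoly] at h0
  rw [eval_pderiv_one_limaconPoly] at h1
  rw [mem_zeroSet_limaconPoly] at hp
  have hN : 0 < p 0 ^ 2 + p 1 ^ 2 := by
    rw [← norm_sq_plane]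
    exact pow_pos (norm_pos_iff.mpr hp0) 2
  have h2 : (p 0 ^ 2 + p 1 ^ 2 - (a * p 0 + b * p 1)) * (p 0 ^ 2 + p 1 ^ 2) = 0 := by
    linear_combination (p 0 * h0 + p 1 * h1) / 2 - hp
  have h3 := (mul_eq_zero.mp h2).resolve_right hN.ne'
  rw [h3] at hp
  have : 0 < r ^ 2 * (p 0 ^ 2 + p 1 ^ 2) := by positivity
  linarith

/-- At a zero of `F` the product rule leaves `G ∂F = c ∂Q`. -/
theorem IsNonsingularAt.of_mul_eq {F G Q : MvPolynomial (Fin 2) ℝ} {c : ℝ} (hc : c ≠ 0)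
    (h : G * F = MvPolynomial.C c * Q) {p : Plane} (hp : p ∈ zeroSet F)
    (hQ : IsNonsingularAt Q p) : IsNonsingularAt F p := by
  obtain ⟨i, hi⟩ := hQ
  refine ⟨i, fun h0 => mul_ne_zero hc hi ?_⟩
  have h1 := congrArg (fun P => MvPolynomial.eval (fun j => p j) (MvPolynomial.pderiv i P)) h
  have hp : MvPolynomial.eval (fun j => p j) F = 0 := hp
  simp [Derivation.leibniz, h0, hp] at h1
  simpa [eq_comm] using h1

/-- At a nonzero point of the curve, Cauchy–Schwarz gives `N - 2⟨c, p⟩ ≥ r² - |c|²` with `N = |p|²`;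
the opposite strict inequality defines a neighbourhood of the origin. -/
theorem isIsolatedPointOf_limacon (h : a ^ 2 + b ^ 2 < r ^ 2) :
    IsIsolatedPointOf (zeroSet (limaconPoly a b r)) 0 := by
  refine ⟨{p | (p 0 ^ 2 + p 1 ^ 2) - 2 * (a * p 0 + b * p 1) < r ^ 2 - (a ^ 2 + b ^ 2)}, ?_, ?_⟩
  · exact isOpen_lt (by fun_prop) (by fun_prop)
  · ext p
    constructor
    · rintro ⟨hp, hp'⟩
      by_contra hp0
      have hN : 0 < p 0 ^ 2 + p 1 ^ 2 := by
        rw [← norm_sq_plane]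
        exact pow_pos (norm_pos_iff.mpr hp0) 2
      rw [mem_zeroSet_limaconPoly] at hp
      rw [mem_ofPred_eq] at hp'
      nlinarith [sq_nonneg (a * p 1 - b * p 0), mul_lt_mul_of_pos_right hp' hN]
    · rintro rfl
      refine ⟨?_, ?_⟩
      · simp [mem_zeroSet_limaconPoly]
      · simp
        linarith

open MvPolynomial in
/-- An irreducible polynomial dividing the limaçon polynomial is its reduced equation. -/
theorem equations_of_dvd {F : MvPolynomial (Fin 2) ℝ} (hF : Irreducible F) (hr : 0 < r)
    (hdvd : F ∣ limaconPoly a b r) (hne : ∃ p ∈ zeroSet F, p ≠ 0) :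
    (a ≠ 0 ∨ b ≠ 0 → ∃ c : ℝ, c ≠ 0 ∧ F = C c * limaconPoly a b r) ∧
      (a = 0 → b = 0 → ∃ c : ℝ, c ≠ 0 ∧ (X 0 ^ 2 + X 1 ^ 2) * F = C c * limaconPoly a b r) := by
  refine ⟨fun hab => eq_C_mul_limaconPoly_of_dvd hF hr hab hdvd, ?_⟩
  rintro rfl rfl
  obtain ⟨p, hp, hp0⟩ := hne
  obtain ⟨c, hc, rfl⟩ := eq_C_mul_circlePoly_of_dvd hF hr hdvd (v := fun i => p i)
    (fun h => hp0 (by ext i; exact congrFun h i)) hp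
  refine ⟨c, hc, ?_⟩
  simp [limaconPoly]
  ring

end PlaneCurve

end

theorem theorem5p1
    (F : MvPolynomial (Fin 2) ℝ) (hF : Irreducible F)
    (𝒞 : Set PlaneCurve.Plane)
    (h𝒞 : 𝒞 = PlaneCurve.zeroSet F ∨ 𝒞 = insert 0 (PlaneCurve.zeroSet F))
    (a b r : ℝ) (hr : 0 < r)
    (hPr : closure (PlaneCurve.primitive 𝒞) = PlaneCurve.circle a b r) :
    -- (1) the equation of the curve, as a set and as a polynomial
    ((a ≠ 0 ∨ b ≠ 0 ∨ 0 ∈ 𝒞 → 𝒞 = PlaneCurve.zeroSet (PlaneCurve.limaconPoly a b r)) ∧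
      (a = 0 → b = 0 → 0 ∉ 𝒞 → 𝒞 = PlaneCurve.zeroSet (PlaneCurve.limaconPoly a b r) \ {0}) ∧
      (a ≠ 0 ∨ b ≠ 0 → ∃ c : ℝ, c ≠ 0 ∧
        F = MvPolynomial.C c * PlaneCurve.limaconPoly a b r) ∧
      (a = 0 → b = 0 → ∃ c : ℝ, c ≠ 0 ∧
        (MvPolynomial.X 0 ^ 2 + MvPolynomial.X 1 ^ 2) * F
          = MvPolynomial.C c * PlaneCurve.limaconPoly a b r) ∧
      -- the curve is the limaçon
      (r ^ 2 ≤ a ^ 2 + b ^ 2 → 𝒞 = Set.range (PlaneCurve.limacon a b r)) ∧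
      (a ^ 2 + b ^ 2 < r ^ 2 → 𝒞 \ {0} = Set.range (PlaneCurve.limacon a b r)) ∧
      -- its inversion
      PlaneCurve.IsIrreducibleQuadraticCurve (PlaneCurve.inversionImage 𝒞) ∧
      PlaneCurve.inversionImage 𝒞 = PlaneCurve.invConic a b r) ∧
    -- (2)
    (a ^ 2 + b ^ 2 - r ^ 2 = 0 →
      PlaneCurve.IsParabola (PlaneCurve.inversionImage 𝒞) ∧
      PlaneCurve.HasOrdinaryCuspAt 𝒞 0) ∧
    -- (3)
    (a ^ 2 + b ^ 2 - r ^ 2 < 0 →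
      PlaneCurve.IsEllipse (PlaneCurve.inversionImage 𝒞) ∧
      (a ≠ 0 ∨ b ≠ 0 ∨ 0 ∈ 𝒞 → PlaneCurve.IsIsolatedPointOf 𝒞 0) ∧
      (∀ p ∈ 𝒞, p ≠ 0 → PlaneCurve.IsNonsingularAt F p) ∧
      (∀ θ : ℝ, deriv (PlaneCurve.limacon a b r) θ ≠ 0)) ∧
    -- (4)
    (0 < a ^ 2 + b ^ 2 - r ^ 2 →
      PlaneCurve.IsHyperbola (PlaneCurve.inversionImage 𝒞) ∧
      PlaneCurve.HasNodeAt 𝒞 0 ∧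
      (∀ p ∈ 𝒞, p ≠ 0 → PlaneCurve.IsNonsingularAt F p) ∧
      PlaneCurve.IsFrontOn (PlaneCurve.limacon a b r) Set.univ ∧
      (∀ θ : ℝ, deriv (PlaneCurve.limacon a b r) θ ≠ 0)) := by
  open PlaneCurve in
  have hsub : 𝒞 ⊆ insert 0 (zeroSet F) := by
    rcases h𝒞 with rfl | rfl
    · exact Set.subset_insert _ _
    · exact subset_rfl
  have hsup : zeroSet F ⊆ 𝒞 := by
    rcases h𝒞 with rfl | rfl
    · exact subset_rfl
    · exact Set.subset_insert _ _
  obtain ⟨hdvd, hne⟩ := dvd_limaconPoly_of_primitive hF hsub hr hPr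
  obtain ⟨heq, heq0⟩ := equations_of_dvd hF hr hdvd hne
  have hzero : (0 : Plane) ∈ zeroSet (limaconPoly a b r) := by simp [mem_zeroSet_limaconPoly]
  -- The cofactor `G` is `1`, or `x² + y²` when `a = b = 0`; it treats both cases at once away from
  -- the origin.
  obtain ⟨G, c, hc, hG0, hG⟩ : ∃ (G : MvPolynomial (Fin 2) ℝ) (c : ℝ), c ≠ 0 ∧
      (∀ p : Plane, p ≠ 0 → MvPolynomial.eval (fun i => p i) G ≠ 0) ∧
      G * F = MvPolynomial.C c * limaconPoly a b r := by
    by_cases hab : a ≠ 0 ∨ b ≠ 0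
    · obtain ⟨c, hc, h⟩ := heq hab
      exact ⟨1, c, hc, by simp, by rw [one_mul, h]⟩
    · push Not at hab
      obtain ⟨c, hc, h⟩ := heq0 hab.1 hab.2
      refine ⟨_, c, hc, fun p hp => ?_, h⟩
      simpa [norm_sq_plane] using pow_ne_zero 2 (norm_ne_zero_iff.mpr hp)
  have hmem : ∀ p : Plane, p ≠ 0 → (p ∈ zeroSet F ↔ p ∈ zeroSet (limaconPoly a b r)) := by
    intro p hp
    have h := congrArg (MvPolynomial.eval (fun i => p i)) hG
    rw [map_mul, map_mul, MvPolynomial.eval_C] at h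
    constructor
    · intro h0
      rw [show MvPolynomial.eval (fun i => p i) F = 0 from h0, mul_zero] at h
      exact (mul_eq_zero.mp h.symm).resolve_left hc
    · intro h0
      rw [show MvPolynomial.eval (fun i => p i) (limaconPoly a b r) = 0 from h0, mul_zero] at h
      exact (mul_eq_zero.mp h).resolve_left (hG0 p hp)
  have hC : ∀ p : Plane, p ≠ 0 → (p ∈ 𝒞 ↔ p ∈ zeroSet (limaconPoly a b r)) := by
    intro p hp
    rw [← hmem p hp]
    exact ⟨fun h => (hsub h).resolve_left hp, fun h => hsup h⟩
  have hdiff : 𝒞 \ {0} = zeroSet (limaconPoly a b r) \ {0} := by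
    ext p
    exact and_congr_left fun hp => hC p hp
  have hset : a ≠ 0 ∨ b ≠ 0 ∨ 0 ∈ 𝒞 → 𝒞 = zeroSet (limaconPoly a b r) := by
    intro h
    have h0 : (0 : Plane) ∈ 𝒞 := by
      by_cases hab : a ≠ 0 ∨ b ≠ 0
      · obtain ⟨c, -, hFc⟩ := heq hab
        have h1 : MvPolynomial.eval (fun i => (0 : Plane) i) (limaconPoly a b r) = 0 := hzero
        apply hsup
        change MvPolynomial.eval _ F = 0
        rw [hFc, map_mul, h1, mul_zero]
      · tauto
    ext p
    by_cases hp : p = 0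
    · simp [hp, h0, hzero]
    · exact hC p hp
  have hab_of : 0 < a ^ 2 + b ^ 2 → a ≠ 0 ∨ b ≠ 0 := by
    intro h
    by_contra! h'
    simp [h'.1, h'.2] at h
  have hinv := inversionImage_eq_invConic hdiff
  have hns : ∀ p ∈ 𝒞, p ≠ 0 → IsNonsingularAt F p := fun p hp hp0 =>
    (isNonsingularAt_limaconPoly hr ((hC p hp0).mp hp) hp0).of_mul_eq hc hG
      ((hsub hp).resolve_left hp0)
  have hset' : 0 < a ^ 2 + b ^ 2 → 𝒞 = zeroSet (limaconPoly a b r) := fun h =>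
    hset ((hab_of h).imp_right Or.inl)
  have hr2 : 0 < r ^ 2 := by positivity
  refine ⟨⟨hset, fun _ _ h => ?_, heq, heq0, fun h => ?_, fun h => ?_, ?_, hinv⟩, fun h => ?_,
    fun h => ?_, fun h => ?_⟩
  · rw [← hdiff, Set.sdiff_singleton_eq_self h]
  · rw [hset' (by linarith)]
    ext p
    constructor
    · intro hp
      by_cases hp0 : p = 0
      · exact hp0 ▸ zero_mem_range_limacon hr h
      · exact mem_range_limacon hp hp0
    · rintro ⟨θ, rfl⟩
      exact limacon_mem_zeroSet a b r θ
  · rw [hdiff]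
    ext p
    constructor
    · rintro ⟨hp, hp0⟩
      exact mem_range_limacon hp hp0
    · rintro ⟨θ, rfl⟩
      exact ⟨limacon_mem_zeroSet a b r θ, limacon_eq_zero_iff.not.mpr (polarRadius_ne_zero h θ)⟩
  · rw [hinv]
    exact isIrreducibleQuadraticCurve_invConic hr
  · rw [hinv, hset' (by linarith)]
    exact ⟨isParabola_invConic hr (by linarith), hasOrdinaryCuspAt_limacon hr (by linarith)⟩
  · refine ⟨hinv ▸ isEllipse_invConic hr (by linarith), fun h0 => ?_, hns, fun θ => ?_⟩
    · rw [hset h0]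
      exact isIsolatedPointOf_limacon (by linarith)
    · rw [(hasDerivAt_limacon a b r θ).deriv]
      exact limaconVelocity_ne_zero (by linarith) θ
  · refine ⟨hinv ▸ isHyperbola_invConic hr (by linarith), ?_, hns, isFrontOn_limacon (by linarith),
      fun θ => ?_⟩
    · rw [hset' (by linarith)]
      exact hasNodeAt_limacon hr (by linarith)
    · rw [(hasDerivAt_limacon a b r θ).deriv]
      exact limaconVelocity_ne_zero (by linarith) θ
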